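/- Let $a_1=(0,0)$, $a_2=(1,0)$, $a_3=(1/2,\sqrt3/2)$, $\mathbf F_i(x)=\tfrac12(x+a_i)$ for $x\in\mathbb R^2$, $\mathrm V_0=\{a_1,a_2,a_3\}$, $\mathrm V_{m+1}=\bigcup_i\mathbf F_i(\mathrm V_m)$, and let $\mathbb S$ be the closure of $\bigcup_m\mathrm V_m$ (the compact Sierpinski gasket). For a finite word $w=w_1\dots w_m$ in $\{1,2,3\}$, $|w|=m$, put $\mathbf F_w=\mathbf F_{w_1}\cdots\mathbf F_{w_m}$ and $\mathbb S_w=\mathbf F_w(\mathbb S)$. Let $\nu$ be the Borel probability measure on $\mathbb S$ with $\nu(\mathbb S_w)=3^{-|w|}$ for all $w$. Let $\mathcal E(u)=\lim_{m\to\infty}\mathcal E^{(m)}(u)\in[0,\infty]$, where $$\mathcal E^{(m)}(u)=\tfrac12\,(5/3)^m\sum_{|w|=m}\ \sum_{x,y\in \mathbf F_w(\mathrm V_0)}[u(x)-u(y)]^2$$ is non-decreasing in $m$, and let $\mathcal F(\mathbb S)$ be the set of $u\in C(\mathbb S)$ with $\mathcal E(u)<\infty$. Define $\delta_s>0$ by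 $1/\delta_s=\log 5/\log 3-1$. We use $1/\infty=0$, $0^0=1$ and $[t]^+=\max(t,0)$. Let $1\le p\le q\le\infty$, $q\ge2$, and let $\sigma$ be a finite Borel measure on $\mathbb S$. **(a)** Let $\bar\delta\in[1,\infty]$ and $C_\sigma>0$ be such that $\sigma(\mathbb S_w)\le C_\sigma\,\nu(\mathbb S_w)^{1/\bar\delta}$ for all words $w$, and let $$a=\Big[\frac{1/p-1/(q\bar\delta)}{1/p+1/(2\delta_s)}\Big]^+ .$$ Then there is a constant $C>0$ depending only on $C_\sigma$ such that for all $u\in\mathcal F(\mathbb S)$ and all constants $c$ with $\min_{\mathbb S}u\le c\le\max_{\mathbb S}u$, $$\|u-c\|_{L^q(\sigma)}\le C\,\mathcal E(u)^{a/2}\,\|u-c\|_{L^p(\nu)}^{1-a},\qquad(1)$$ and for all $u\in\mathcal F(\mathbb S)$, $$\|u\|_{L^q(\sigma)}\le C\,\big[\mathcal E(u)^{a/2}\|u\|_{L^p(\nu)}^{1-a}+\|u\|_{L^p(\nu)}\big].\qquad(2)$$ Moreover, suppose that the exponent $1/\bar\delta$ is attained by $\sigma$, in the sense that there is a sequence of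 words $w_n$ with $\operatorname{diam}(\mathbb S_{w_n})\to0$, $\sigma(\mathbb S_{w_n})>0$ and $\log\sigma(\mathbb S_{w_n})/\log\nu(\mathbb S_{w_n})\to1/\bar\delta$. Then the exponent $a$ is optimal: if for some $b\in[0,1]$ and some constant $C$ the inequality (1) holds with $b$ in place of $a$ for all such $u$ and $c$, then $b\ge a$. **(b)** Let $\underline\delta\in(0,\infty]$ and $C_\sigma>0$ be such that $C_\sigma^{-1}\nu(\mathbb S_w)^{1/\underline\delta}\le\sigma(\mathbb S_w)$ for all words $w$. Then all conclusions of (a) hold with $\sigma$ and $\nu$ exchanged in (1) and (2) and with the exponent $$a=\Big[\frac{1/(p\underline\delta)-1/q}{1/(p\underline\delta)+1/(2\delta_s)}\Big]^+ ;$$ that is, (1) and (2) so modified hold with a constant $C>0$ depending only on $C_\sigma$, and if $1/\underline\delta$ is attained by $\sigma$ in the above sense, then this exponent is optimal: if the modified inequality (1) holds with some $b\in[0,1]$ in place of $a$, for some constant $C$ and all such $u$ and $c$, then $b\ge a$. -/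

import Mathlib

open MeasureTheory Filter Topology
open scoped ENNReal NNReal

namespace SierpinskiGasket

/-! ### The compact Sierpinski gasket -/

/-- The Euclidean plane. -/
abbrev Plane : Type := EuclideanSpace ℝ (Fin 2)

/-- The three corners `(0,0)`, `(1,0)`, `(1/2, √3/2)`. -/
noncomputable def corner : Fin 3 → Plane :=
  ![!₂[0, 0], !₂[1, 0], !₂[1 / 2, √3 / 2]]

/-- The contractions `x ↦ (x + corner i) / 2` of the plane. -/
noncomputable def contr (i : Fin 3) (x : Plane) : Plane := (1 / 2 : ℝ) • (x + corner i)

/-- The vertex sets `V_m`: `V_0` consists of the corners, `V_{m+1} = ⋃ i, contr i '' V_m`. -/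
noncomputable def vertices : ℕ → Set Plane
  | 0 => Set.range corner
  | m + 1 => ⋃ i, contr i '' vertices m

/-- The compact Sierpinski gasket, the closure of `⋃ m, V_m`, as a set. -/
noncomputable def gasketSet : Set Plane := closure (⋃ m, vertices m)

/-- The compact Sierpinski gasket as a (metric, Borel measurable) space. -/
abbrev Gasket : Type := gasketSet

theorem continuous_contr (i : Fin 3) : Continuous (contr i) := by
  unfold contr; fun_prop

theorem vertices_subset (m : ℕ) : vertices m ⊆ gasketSet :=
  (Set.subset_iUnion vertices m).trans subset_closure

theorem isClosed_gasketSet : IsClosed gasketSet := isClosed_closure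

theorem contr_mem (i : Fin 3) {x : Plane} (hx : x ∈ gasketSet) : contr i x ∈ gasketSet := by
  have h : Set.MapsTo (contr i) (⋃ m, vertices m) (⋃ m, vertices m) := by
    intro y hy
    obtain ⟨m, hm⟩ := Set.mem_iUnion.1 hy
    exact Set.mem_iUnion.2 ⟨m + 1, Set.mem_iUnion.2 ⟨i, y, hm, rfl⟩⟩
  exact h.closure (continuous_contr i) hx

/-- The corners as points of the gasket. -/
noncomputable def vertex (i : Fin 3) : Gasket :=
  ⟨corner i, vertices_subset 0 ⟨i, rfl⟩⟩

/-- The contractions as self-maps of the gasket. -/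
noncomputable def F (i : Fin 3) (x : Gasket) : Gasket := ⟨contr i x, contr_mem i x.2⟩

/-- `cellMap [i₁, …, i_m] = F i₁ ∘ ⋯ ∘ F i_m` for a finite word. -/
noncomputable def cellMap : List (Fin 3) → Gasket → Gasket
  | [] => id
  | i :: w => F i ∘ cellMap w

/-- The cell `𝕊_w = F_w(𝕊)` of a finite word `w`. -/
noncomputable def cell (w : List (Fin 3)) : Set Gasket := Set.range (cellMap w)

/-! ### The standard Dirichlet form -/

/-- The level-`m` energy: the sum of `(5/3)^m (u x - u y)^2` over the edges `{x, y}` of the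
level-`m` graph, whose edges join two distinct points of `F_w(V_0)` for a word `w` of length `m`.
The factor `1/2` compensates for counting every edge twice, as `(x, y)` and as `(y, x)`. -/
noncomputable def levelEnergy (m : ℕ) (u : Gasket → ℝ) : ℝ :=
  ∑ w : Fin m → Fin 3, ∑ i : Fin 3, ∑ j : Fin 3, (1 / 2 : ℝ) * (5 / 3) ^ m *
    (u (cellMap (List.ofFn w) (vertex i)) - u (cellMap (List.ofFn w) (vertex j))) ^ 2

/-- The energy `𝓔(u) = lim_m 𝓔^{(m)}(u) ∈ [0, ∞]`. The sequence is non-decreasing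
(`levelEnergy_le_succ`), so that its limit is its supremum (`tendsto_levelEnergy`). -/
noncomputable def energy (u : Gasket → ℝ) : ℝ≥0∞ := ⨆ m, ENNReal.ofReal (levelEnergy m u)

/-- The domain `𝓕(𝕊)` of the standard Dirichlet form: the continuous functions of finite energy. -/
noncomputable def FiniteEnergy : Set C(Gasket, ℝ) := {u | energy u < ∞}

theorem levelEnergy_succ (m : ℕ) (u : Gasket → ℝ) :
    levelEnergy (m + 1) u = ∑ k, 5 / 3 * levelEnergy m (u ∘ F k) := by
  unfold levelEnergy
  rw [← (Fin.consEquiv (fun _ => Fin 3)).sum_comp, Fintype.sum_prod_type]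
  refine Finset.sum_congr rfl fun k _ => ?_
  rw [Finset.mul_sum]
  refine Finset.sum_congr rfl fun w _ => ?_
  rw [Finset.mul_sum]
  refine Finset.sum_congr rfl fun i _ => ?_
  rw [Finset.mul_sum]
  refine Finset.sum_congr rfl fun j _ => ?_
  have hw : List.ofFn (Fin.consEquiv (fun _ => Fin 3) (k, w)) = k :: List.ofFn w :=
    List.ofFn_cons k w
  rw [hw]
  simp only [cellMap, Function.comp_apply]
  ring

theorem F_vertex_comm (i j : Fin 3) : F i (vertex j) = F j (vertex i) := by
  ext1
  simp [F, vertex, contr, add_comm]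

theorem F_vertex_self (i : Fin 3) : F i (vertex i) = vertex i := by
  ext1
  simp only [F, vertex, contr]
  rw [← two_smul ℝ, smul_smul]; norm_num

theorem levelEnergy_le_succ (m : ℕ) (u : Gasket → ℝ) :
    levelEnergy m u ≤ levelEnergy (m + 1) u := by
  induction m generalizing u with
  | zero =>
    rw [levelEnergy_succ]
    simp only [levelEnergy, Fin.sum_univ_three, Fin.isValue, Finset.univ_unique,
      Finset.sum_singleton, cellMap, Function.comp_apply, List.ofFn_zero, id,
      F_vertex_self, F_vertex_comm 1 0, F_vertex_comm 2 0, F_vertex_comm 2 1]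
    generalize u (vertex 0) = a
    generalize u (vertex 1) = b
    generalize u (vertex 2) = c
    generalize u (F 0 (vertex 1)) = x
    generalize u (F 0 (vertex 2)) = y
    generalize u (F 1 (vertex 2)) = z
    nlinarith [sq_nonneg (5 * x - 2 * a - 2 * b - c + (5 * y - 2 * a - 2 * c - b)
        + (5 * z - 2 * b - 2 * c - a)),
      sq_nonneg ((5 * x - 2 * a - 2 * b - c) - (5 * y - 2 * a - 2 * c - b)),
      sq_nonneg ((5 * x - 2 * a - 2 * b - c) - (5 * z - 2 * b - 2 * c - a)),
      sq_nonneg ((5 * y - 2 * a - 2 * c - b) - (5 * z - 2 * b - 2 * c - a))]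
  | succ m ih =>
    rw [levelEnergy_succ, levelEnergy_succ (m + 1)]
    exact Finset.sum_le_sum fun k _ => mul_le_mul_of_nonneg_left (ih _) (by norm_num)

theorem tendsto_levelEnergy (u : Gasket → ℝ) :
    Tendsto (fun m => ENNReal.ofReal (levelEnergy m u)) atTop (𝓝 (energy u)) :=
  tendsto_atTop_iSup (monotone_nat_of_le_succ fun m =>
    ENNReal.ofReal_le_ofReal (levelEnergy_le_succ m u))

/-! ### The Hausdorff measure -/

theorem norm_corner_le (i : Fin 3) : ‖corner i‖ ≤ 1 := by
  fin_cases i <;> simp [corner, EuclideanSpace.norm_eq, Fin.sum_univ_two]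
  norm_num [div_pow]

theorem summable_code (ω : ℕ → Fin 3) :
    Summable fun k => (1 / 2 : ℝ) ^ (k + 1) • corner (ω k) := by
  refine Summable.of_norm_bounded (g := fun k => (1 / 2 : ℝ) ^ (k + 1)) ?_ fun k => ?_
  · exact (summable_nat_add_iff 1).2 summable_geometric_two
  · rw [norm_smul, norm_pow]
    rw [show ‖(1 / 2 : ℝ)‖ = 1 / 2 by norm_num]
    exact mul_le_of_le_one_right (by positivity) (norm_corner_le (ω k))

theorem partialSum_mem (ω : ℕ → Fin 3) (n : ℕ) :
    ∑ k ∈ Finset.range n, (1 / 2 : ℝ) ^ (k + 1) • corner (ω k) ∈ vertices n := by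
  induction n generalizing ω with
  | zero => exact ⟨0, by ext i; fin_cases i <;> simp [corner]⟩
  | succ n ih =>
    refine Set.mem_iUnion.2 ⟨ω 0, _, ih (fun k => ω (k + 1)), ?_⟩
    rw [Finset.sum_range_succ', contr, smul_add, Finset.smul_sum]
    congr 1
    · refine Finset.sum_congr rfl fun k _ => ?_
      rw [smul_smul]; congr 1; ring
    · simp

/-- The coding map: the sequence `ω₀ω₁ω₂…` is sent to the unique point of the intersection of the
cells of its initial words, the point `∑ k, 2^{-(k+1)} corner (ω k)`. -/
noncomputable def code (ω : ℕ → Fin 3) : Gasket :=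
  ⟨∑' k, (1 / 2 : ℝ) ^ (k + 1) • corner (ω k),
    isClosed_gasketSet.mem_of_tendsto (summable_code ω).hasSum.tendsto_sum_nat
      (Eventually.of_forall fun n => vertices_subset n (partialSum_mem ω n))⟩

/-- The uniform distribution on sequences with values in `Fin 3`. -/
noncomputable def coin : Measure (ℕ → Fin 3) :=
  Measure.infinitePi fun _ => (PMF.uniformOfFintype (Fin 3)).toMeasure

/-- The (normalised) Hausdorff measure `ν` on the gasket: the law of the point coded by a uniformly
distributed sequence. It is the Borel probability measure with `ν (𝕊_w) = 3^{-|w|}` for every word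
`w` (`nu_cell`). -/
noncomputable def nu : Measure Gasket := coin.map code

theorem continuous_code : Continuous code := by
  refine Continuous.subtype_mk ?_ _
  refine continuous_tsum (u := fun k => (1 / 2 : ℝ) ^ (k + 1)) (fun k => ?_) ?_ fun k ω => ?_
  · have h : Continuous fun ω : ℕ → Fin 3 => corner (ω k) :=
      (continuous_of_discreteTopology (f := corner)).comp
        (continuous_apply (A := fun _ : ℕ => Fin 3) k)
    exact h.const_smul ((1 / 2 : ℝ) ^ (k + 1))
  · exact (summable_nat_add_iff 1).2 summable_geometric_two
  · rw [norm_smul, norm_pow]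
    rw [show ‖(1 / 2 : ℝ)‖ = 1 / 2 by norm_num]
    exact mul_le_of_le_one_right (by positivity) (norm_corner_le (ω k))

instance : IsProbabilityMeasure coin := by unfold coin; infer_instance

instance : IsProbabilityMeasure nu :=
  Measure.isProbabilityMeasure_map continuous_code.measurable.aemeasurable

theorem code_eq (ω : ℕ → Fin 3) : code ω = F (ω 0) (code fun k => ω (k + 1)) := by
  ext1
  simp only [code, F, contr]
  rw [(summable_code ω).tsum_eq_zero_add, smul_add, ← Summable.tsum_const_smul _ (summable_code _),
    add_comm]
  congr 1
  · refine tsum_congr fun k => ?_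
    rw [smul_smul]; congr 1; ring
  · simp

theorem F_injective (i : Fin 3) : Function.Injective (F i) := by
  intro x y h
  have h1 : contr i x = contr i y := congrArg Subtype.val h
  ext1
  simpa [contr] using h1

/-- Barycentric coordinates with respect to the three corners. -/
noncomputable def bary (j : Fin 3) (x : Plane) : ℝ :=
  ![1 - x 0 - x 1 / √3, x 0 - x 1 / √3, 2 * x 1 / √3] j

theorem bary_contr (i j : Fin 3) (x : Plane) :
    bary j (contr i x) = (bary j x + if i = j then 1 else 0) / 2 := by
  have h3 : √3 ≠ 0 := by positivity
  have hs : √3 * √3 = 3 := Real.mul_self_sqrt (by norm_num)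
  fin_cases i <;> fin_cases j <;> simp [bary, contr, corner] <;> field_simp <;> ring_nf

theorem sum_bary (x : Plane) : bary 0 x + bary 1 x + bary 2 x = 1 := by
  simp [bary]; ring

theorem continuous_bary (j : Fin 3) : Continuous (bary j) := by
  fin_cases j
  · change Continuous fun x : Plane => 1 - x 0 - x 1 / √3
    fun_prop
  · change Continuous fun x : Plane => x 0 - x 1 / √3
    fun_prop
  · change Continuous fun x : Plane => 2 * x 1 / √3
    fun_prop

theorem bary_nonneg (j : Fin 3) {x : Plane} (hx : x ∈ gasketSet) : 0 ≤ bary j x := by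
  have h : ∀ m, ∀ y ∈ vertices m, 0 ≤ bary j y := by
    intro m
    induction m with
    | zero =>
      rintro _ ⟨i, rfl⟩
      have h3 : √3 ≠ 0 := by positivity
      fin_cases i <;> fin_cases j <;> simp [bary, corner] <;> field_simp <;> norm_num
    | succ m ih =>
      intro y hy
      obtain ⟨i, z, hz, rfl⟩ := Set.mem_iUnion.1 hy
      rw [bary_contr]
      have := ih z hz
      split_ifs <;> positivity
  refine closure_minimal (t := {y | 0 ≤ bary j y}) ?_
    (isClosed_le continuous_const (continuous_bary j)) hx
  intro y hy
  obtain ⟨m, hm⟩ := Set.mem_iUnion.1 hy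
  exact h m y hm

theorem bary_le_one (j : Fin 3) {x : Plane} (hx : x ∈ gasketSet) : bary j x ≤ 1 := by
  have h := sum_bary x
  have h0 := bary_nonneg 0 hx
  have h1 := bary_nonneg 1 hx
  have h2 := bary_nonneg 2 hx
  fin_cases j <;> simp <;> linarith

/-- Only the constant sequence codes a corner. -/
theorem eq_const_of_bary_eq_one (i : Fin 3) (n : ℕ) (ω : ℕ → Fin 3)
    (h : bary i (code ω : Plane) = 1) : ω n = i := by
  have key : ∀ ω : ℕ → Fin 3, bary i (code ω : Plane) = 1 →
      ω 0 = i ∧ bary i (code (fun k => ω (k + 1)) : Plane) = 1 := by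
    intro ω h
    rw [code_eq ω] at h
    simp only [F] at h
    rw [bary_contr] at h
    have hle := bary_le_one i (code fun k => ω (k + 1)).2
    split_ifs at h with h0
    · exact ⟨h0, by linarith⟩
    · linarith
  induction n generalizing ω with
  | zero => exact (key ω h).1
  | succ n ih => exact ih _ (key ω h).2

theorem code_mem_cell (w : List (Fin 3)) (ω : ℕ → Fin 3) (h : ∀ k : Fin w.length, ω k = w[k]) :
    code ω ∈ cell w := by
  induction w generalizing ω with
  | nil => exact ⟨code ω, rfl⟩
  | cons i w ih =>
    obtain ⟨y, hy⟩ := ih (fun k => ω (k + 1)) fun k => by simpa using h k.succ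
    refine ⟨y, ?_⟩
    have h0 : ω 0 = i := by simpa using h ⟨0, by simp⟩
    rw [code_eq, cellMap, Function.comp_apply, hy, h0]

/-- A point of a cell is coded only by sequences that begin with the word of the cell, apart from
eventually constant sequences. -/
theorem of_code_mem_cell (w : List (Fin 3)) (ω : ℕ → Fin 3) (h : code ω ∈ cell w) :
    (∀ k : Fin w.length, ω k = w[k]) ∨ ∃ i N, ∀ n, ω (n + N) = i := by
  induction w generalizing ω with
  | nil => exact Or.inl fun k => k.elim0
  | cons i w ih =>
    obtain ⟨y, hy⟩ := h
    rw [code_eq, cellMap, Function.comp_apply] at hy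
    by_cases h0 : ω 0 = i
    · rw [h0] at hy
      rcases ih _ ⟨y, F_injective i hy⟩ with h1 | ⟨j, N, h1⟩
      · left
        intro k
        refine Fin.cases ?_ (fun k => ?_) k
        · simpa using h0
        · simpa using h1 k
      · exact Or.inr ⟨j, N + 1, h1⟩
    · right
      refine ⟨i, 1, fun n => ?_⟩
      refine eq_const_of_bary_eq_one i n (fun k => ω (k + 1)) ?_
      have hv : contr i (cellMap w y) = contr (ω 0) (code fun k => ω (k + 1)) :=
        congrArg Subtype.val hy
      have hb := congrArg (bary i) hv
      rw [bary_contr, bary_contr, if_pos rfl, if_neg h0] at hb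
      have := bary_nonneg i (cellMap w y).2
      have := bary_le_one i (code fun k => ω (k + 1)).2
      linarith

theorem coin_cylinder (s : Finset ℕ) (f : ℕ → Fin 3) :
    coin {ω | ∀ k ∈ s, ω k = f k} = (3⁻¹ : ℝ≥0∞) ^ s.card := by
  have h := Measure.infinitePi_pi (fun _ : ℕ => (PMF.uniformOfFintype (Fin 3)).toMeasure)
    (s := s) (t := fun k => {f k}) fun _ _ => measurableSet_singleton _
  have hset : {ω : ℕ → Fin 3 | ∀ k ∈ s, ω k = f k} = Set.pi s fun k => {f k} := by
    ext ω; simp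
  rw [coin, hset, h]
  simp

theorem coin_eventuallyConst : coin {ω | ∃ i N, ∀ n, ω (n + N) = i} = 0 := by
  have hset : {ω : ℕ → Fin 3 | ∃ i N, ∀ n, ω (n + N) = i} =
      ⋃ i : Fin 3, ⋃ N : ℕ, {ω | ∀ n, ω (n + N) = i} := by
    ext ω; simp
  rw [hset]
  refine measure_iUnion_null fun i => measure_iUnion_null fun N => ?_
  have hle : ∀ n : ℕ, coin {ω | ∀ n, ω (n + N) = i} ≤ (3⁻¹ : ℝ≥0∞) ^ n := by
    intro n
    have h := coin_cylinder ((Finset.range n).map (addRightEmbedding N)) fun _ => i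
    rw [Finset.card_map, Finset.card_range] at h
    rw [← h]
    refine measure_mono fun ω hω => ?_
    intro k hk
    obtain ⟨l, -, rfl⟩ := Finset.mem_map.1 hk
    exact hω l
  have h0 : Tendsto (fun n : ℕ => (3⁻¹ : ℝ≥0∞) ^ n) atTop (𝓝 0) :=
    ENNReal.tendsto_pow_atTop_nhds_zero_of_lt_one (by
      rw [ENNReal.inv_lt_one]; norm_num)
  exact le_antisymm (ge_of_tendsto' h0 hle) bot_le

theorem measurableSet_cell (w : List (Fin 3)) : MeasurableSet (cell w) := by
  have hc : Continuous (cellMap w) := by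
    induction w with
    | nil => exact continuous_id
    | cons i w ih =>
      exact (((continuous_contr i).comp continuous_subtype_val).subtype_mk _).comp ih
  have hb : Bornology.IsBounded gasketSet := by
    refine Bornology.IsBounded.closure ?_
    refine (Metric.isBounded_closedBall (x := (0 : Plane)) (r := 1)).subset ?_
    refine Set.iUnion_subset fun m => ?_
    induction m with
    | zero => rintro _ ⟨i, rfl⟩; simpa using norm_corner_le i
    | succ m ih =>
      refine Set.iUnion_subset fun i => ?_
      rintro _ ⟨x, hx, rfl⟩
      have h1 : ‖x‖ ≤ 1 := by simpa using ih hx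
      have h2 := norm_add_le x (corner i)
      have h3 := norm_corner_le i
      rw [mem_closedBall_zero_iff, contr, norm_smul]
      norm_num
      linarith
  have : CompactSpace Gasket :=
    isCompact_iff_compactSpace.1 (Metric.isCompact_of_isClosed_isBounded isClosed_gasketSet hb)
  exact (isCompact_range hc).isClosed.measurableSet

/-- The defining property of the Hausdorff measure of the gasket. -/
theorem nu_cell (w : List (Fin 3)) : nu (cell w) = (3⁻¹ : ℝ≥0∞) ^ w.length := by
  rw [nu, Measure.map_apply continuous_code.measurable (measurableSet_cell w)]
  have hcyl : coin {ω | ∀ k : Fin w.length, ω k = w[k]} = (3⁻¹ : ℝ≥0∞) ^ w.length := by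
    have h := coin_cylinder (Finset.range w.length) fun k => w.getD k 0
    rw [Finset.card_range] at h
    rw [← h]
    congr 1
    ext ω
    simp only [Set.mem_ofPred_eq, Finset.mem_range]
    constructor
    · intro h k hk
      simpa [hk] using h ⟨k, hk⟩
    · intro h k
      simpa using h k k.2
  rw [← hcyl]
  refine le_antisymm ?_ (measure_mono fun ω hω => code_mem_cell w ω hω)
  calc coin (code ⁻¹' cell w)
      ≤ coin ({ω | ∀ k : Fin w.length, ω k = w[k]} ∪ {ω | ∃ i N, ∀ n, ω (n + N) = i}) :=
        measure_mono fun ω hω => of_code_mem_cell w ω hω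
    _ ≤ _ := measure_union_le _ _
    _ = _ := by rw [coin_eventuallyConst, add_zero]

/-! ### Conditions and inequalities -/

/-- The constant `δ_s`, given by `1/δ_s = log 5 / log 3 - 1`. -/
noncomputable def deltaS : ℝ := 1 / (Real.log 5 / Real.log 3 - 1)

/-- `σ(𝕊_w) ≤ K ν(𝕊_w)^{1/δ}` for all words `w`; here `1/∞ = 0`. -/
def UpperRegular (σ : Measure Gasket) (δ : ℝ≥0∞) (K : ℝ≥0) : Prop :=
  ∀ w : List (Fin 3), σ (cell w) ≤ K * nu (cell w) ^ (1 / δ).toReal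

/-- `K⁻¹ ν(𝕊_w)^{1/δ} ≤ σ(𝕊_w)` for all words `w`; here `1/∞ = 0`. -/
def LowerRegular (σ : Measure Gasket) (δ : ℝ≥0∞) (K : ℝ≥0) : Prop :=
  ∀ w : List (Fin 3), (K : ℝ≥0∞)⁻¹ * nu (cell w) ^ (1 / δ).toReal ≤ σ (cell w)

/-- The exponent `1/δ` is attained by `σ` along cells that shrink: there are cells `𝕊_{w_n}` of
positive `σ`-measure with diameters tending to `0` and
`log σ(𝕊_{w_n}) / log ν(𝕊_{w_n}) → 1/δ`. -/
def AttainsExponent (σ : Measure Gasket) (δ : ℝ≥0∞) : Prop :=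
  ∃ w : ℕ → List (Fin 3), Tendsto (fun n => Metric.diam (cell (w n))) atTop (𝓝 0) ∧
    (∀ n, 0 < σ (cell (w n))) ∧
    Tendsto (fun n => Real.log (σ (cell (w n))).toReal / Real.log (nu (cell (w n))).toReal)
      atTop (𝓝 (1 / δ).toReal)

/-- The exponent `[(1/p - 1/(qδ)) / (1/p + 1/(2δ_s))]^+`; here `1/∞ = 0`. -/
noncomputable def expUpper (p q δ : ℝ≥0∞) : ℝ :=
  max (((1 / p).toReal - (1 / (q * δ)).toReal) / ((1 / p).toReal + 1 / (2 * deltaS))) 0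

/-- The exponent `[(1/(pδ) - 1/q) / (1/(pδ) + 1/(2δ_s))]^+`; here `1/∞ = 0`. -/
noncomputable def expLower (p q δ : ℝ≥0∞) : ℝ :=
  max (((1 / (p * δ)).toReal - (1 / q).toReal) / ((1 / (p * δ)).toReal + 1 / (2 * deltaS))) 0

/-- `‖u - c‖_{L^q(σ₁)} ≤ C 𝓔(u)^{a/2} ‖u - c‖_{L^p(σ₂)}^{1-a}` for all `u ∈ 𝓕(𝕊)` and all constants
`c` with `min u ≤ c ≤ max u`. -/
def SobolevIneq (σ₁ σ₂ : Measure Gasket) (q p : ℝ≥0∞) (a : ℝ) (C : ℝ≥0) : Prop :=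
  ∀ u ∈ FiniteEnergy, ∀ c : ℝ, (⨅ x, u x) ≤ c → c ≤ (⨆ x, u x) →
    eLpNorm (fun x => u x - c) q σ₁ ≤
      C * energy u ^ (a / 2) * eLpNorm (fun x => u x - c) p σ₂ ^ (1 - a)

/-- `‖u‖_{L^q(σ₁)} ≤ C [𝓔(u)^{a/2} ‖u‖_{L^p(σ₂)}^{1-a} + ‖u‖_{L^p(σ₂)}]` for all `u ∈ 𝓕(𝕊)`. -/
def InhomSobolevIneq (σ₁ σ₂ : Measure Gasket) (q p : ℝ≥0∞) (a : ℝ) (C : ℝ≥0) : Prop :=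
  ∀ u ∈ FiniteEnergy,
    eLpNorm u q σ₁ ≤ C * (energy u ^ (a / 2) * eLpNorm u p σ₂ ^ (1 - a) + eLpNorm u p σ₂)

end SierpinskiGasket

open SierpinskiGasket

namespace SierpinskiGasket

/-! ### Cells and vertices -/

/-! Both parts are instances of one statement about two finite measures: `μ₁`, bounded above on
cells by `K ν(𝕊_w)^α`, and `μ₂`, bounded below by `K⁻¹ ν(𝕊_w)^β`. Part (a) is `α = 1/δ`, `β = 1`,
`μ₂ = ν`; part (b) is `μ₁ = ν`, `α = 1`, `β = 1/δ`. Write `s = α/q`, `t = β/p`, `g = 1/(2δ_s)`, `e =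
𝓔(v)^{1/2}`, and `N`, `P` for the two norms of `v`. The exponent is `a = (t - s)/(t + g)`.

Chaining along vertices bounds the oscillation of a function by `7 𝓔^{1/2}` (`abs_sub_le_energy`).
Applied to `v ∘ F_w`, this bounds `|v|` on a cell by the square root of the local energy plus a
local `L^p`-mean (`enorm_le_of_mem_cell`). Now sum over the cells of level `m`. Self-similarity
makes the local energies add up to `(3/5)^m 𝓔(v)`, and `(3/5)^{m/2} = 3^{-mg}`; the embeddings `ℓ² ⊆
ℓ^q` and `ℓ^p ⊆ ℓ^q` use `2 ≤ q` and `p ≤ q`; each point lies in at most three cells of the level.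
The result is `N ≤ 7K² (3^{-m(s+g)} e + 3^{m(t-s)} P)` for every `m` (`toReal_eLpNorm_le_scale`). If
`P ≤ e`, the best `m` gives `e^a P^{1-a}` up to a constant (`interpolation_of_scales`). If `e ≤ P`,
then (1) follows from `|u - c| ≤ 7e`, because `c` lies in the range of `u`, and (2) follows from the
scale `m = 0`. A positive part is never needed: `s ≤ t` is clear in (a), and in (b) finiteness of
`σ` forces `1/δ ≥ 1` (`one_le_of_lowerRegular`).

Optimality is tested on piecewise harmonic functions of energy of order `(5/3)^m`, which have zeros,
so that `c = 0` is admissible. In (a) the function is `1` on `𝕊_w` and its support has `ν`-measure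
comparable to that of `𝕊_w` (`SobolevIneq.measure_cell_le`). In (b) it is supported inside `𝕊_w` and
bounded below on a subcell of `ν`-measure `ν(𝕊_w)/9` (`SobolevIneq.nu_cell_le`). Logarithms, divided
by `log ν(𝕊_{w_n})`, turn the assumed inequality into `b ≥ a` in the limit
(`rate_le_of_inequality`). -/

theorem code_cons (i : Fin 3) (ω : ℕ → Fin 3) :
    code (fun n => Nat.casesOn n i ω) = F i (code ω) :=
  code_eq _

theorem bary_vertex (i j : Fin 3) : bary j (vertex i : Plane) = if i = j then 1 else 0 := by
  have h := bary_contr i j (vertex i)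
  have h' : contr i (vertex i) = (vertex i : Plane) := congrArg Subtype.val (F_vertex_self i)
  rw [h'] at h
  linarith

theorem vertex_injective : Function.Injective vertex := by
  intro i j h
  have h1 := bary_vertex i j
  rw [h, bary_vertex, if_pos rfl] at h1
  by_contra hne
  simp [hne] at h1

theorem eq_of_bary_eq {x y : Gasket} (h : ∀ j, bary j (x : Plane) = bary j (y : Plane)) :
    x = y := by
  have h3 : √3 ≠ 0 := by positivity
  have h1 := h 1
  have h2 := h 2
  simp only [bary, Matrix.cons_val] at h1 h2
  have e1 : (x : Plane) 1 = (y : Plane) 1 := by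
    field_simp at h2
    linarith
  have e0 : (x : Plane) 0 = (y : Plane) 0 := by
    rw [e1] at h1
    linarith
  ext i
  fin_cases i
  · exact e0
  · exact e1

theorem eq_vertex_of_bary_eq_one {x : Gasket} {i : Fin 3} (h : bary i (x : Plane) = 1) :
    x = vertex i := by
  refine eq_of_bary_eq fun j => ?_
  rw [bary_vertex]
  have hs := sum_bary x
  have h0 := bary_nonneg 0 x.2
  have h1 := bary_nonneg 1 x.2
  have h2 := bary_nonneg 2 x.2
  fin_cases i <;> fin_cases j <;> simp at h ⊢ <;> linarith

theorem code_const (i : Fin 3) : code (fun _ => i) = vertex i := by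
  refine eq_vertex_of_bary_eq_one ?_
  have h := bary_contr i i (code fun _ => i)
  rw [show contr i (code fun _ => i) = (code fun _ => i : Plane) from
    congrArg Subtype.val (code_eq fun _ => i).symm, if_pos rfl] at h
  linarith

/-- The image of `code` is compact, and it contains every vertex, since a vertex is coded by a
finite word followed by a constant sequence. -/
theorem code_surjective : Function.Surjective code := by
  have hsub : gasketSet ⊆ Subtype.val '' Set.range code := by
    refine closure_minimal (Set.iUnion_subset fun m => ?_) ?_
    · induction m with
      | zero =>
        rintro _ ⟨i, rfl⟩
        exact ⟨vertex i, ⟨_, code_const i⟩, rfl⟩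
      | succ m ih =>
        refine Set.iUnion_subset fun i => ?_
        rintro _ ⟨x, hx, rfl⟩
        obtain ⟨_, ⟨ω, rfl⟩, rfl⟩ := ih hx
        exact ⟨_, ⟨_, code_cons i ω⟩, rfl⟩
    · exact ((isCompact_range continuous_code).image continuous_subtype_val).isClosed
  intro x
  obtain ⟨_, ⟨ω, rfl⟩, h⟩ := hsub x.2
  exact ⟨ω, Subtype.ext h⟩

instance : CompactSpace Gasket :=
  ⟨code_surjective.range_eq ▸ isCompact_range continuous_code⟩

instance : Nonempty Gasket := ⟨vertex 0⟩

theorem continuous_F (i : Fin 3) : Continuous (F i) :=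
  ((continuous_contr i).comp continuous_subtype_val).subtype_mk _

theorem continuous_cellMap (w : List (Fin 3)) : Continuous (cellMap w) := by
  induction w with
  | nil => exact continuous_id
  | cons i w ih => exact (continuous_F i).comp ih

theorem exists_F_eq (x : Gasket) : ∃ i y, F i y = x := by
  obtain ⟨ω, rfl⟩ := code_surjective x
  exact ⟨_, _, (code_eq ω).symm⟩

theorem exists_mem_cell (m : ℕ) (x : Gasket) :
    ∃ w : Fin m → Fin 3, x ∈ cell (List.ofFn w) := by
  obtain ⟨ω, rfl⟩ := code_surjective x
  exact ⟨fun k => ω k, code_mem_cell _ _ fun k => by simp⟩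

/-- The barycentric coordinate `j` is at most `1/2` on `F i (𝕊)` and at least `1/2` on `F j (𝕊)`;
equality in the first bound occurs only at the image of the corner `j`. -/
theorem eq_vertex_of_F_eq {i j : Fin 3} (hij : i ≠ j) {x y : Gasket} (h : F i x = F j y) :
    x = vertex j := by
  have hb : bary j (contr i x) = bary j (contr j y) := by
    rw [show contr i x = contr j y from congrArg Subtype.val h]
  rw [bary_contr, bary_contr, if_neg hij, if_pos rfl] at hb
  refine eq_vertex_of_bary_eq_one ?_
  have := bary_nonneg j y.2
  have := bary_le_one j x.2
  linarith

theorem eq_of_F_eq_vertex {i j : Fin 3} {x : Gasket} (h : F i x = vertex j) :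
    i = j ∧ x = vertex j := by
  have hij : i = j := by
    by_contra hne
    have h1 : F i x = F j (vertex j) := by rw [h, F_vertex_self]
    have h2 := eq_vertex_of_F_eq hne h1
    have h3 := eq_vertex_of_F_eq (Ne.symm hne) h1.symm
    exact hne (vertex_injective h3).symm
  subst hij
  exact ⟨rfl, F_injective i (h.trans (F_vertex_self i).symm)⟩

theorem cellMap_injective (w : List (Fin 3)) : Function.Injective (cellMap w) := by
  induction w with
  | nil => exact Function.injective_id
  | cons i w ih => exact (F_injective i).comp ih

theorem cellMap_append (v w : List (Fin 3)) : cellMap (v ++ w) = cellMap v ∘ cellMap w := by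
  induction v with
  | nil => rfl
  | cons i v ih => simp only [List.cons_append, cellMap, ih, Function.comp_assoc]

theorem eq_vertex_of_cellMap_eq_vertex {w : List (Fin 3)} {j : Fin 3} {x : Gasket}
    (h : cellMap w x = vertex j) : x = vertex j ∧ ∀ i ∈ w, i = j := by
  induction w with
  | nil => exact ⟨h, by simp⟩
  | cons i w ih =>
    obtain ⟨rfl, h1⟩ := eq_of_F_eq_vertex h
    obtain ⟨h2, h3⟩ := ih h1
    exact ⟨h2, by simpa using h3⟩

/-- Distinct cells of the same level meet only in vertices. -/
theorem mem_range_vertex_of_cellMap_eq {v w : List (Fin 3)} (hl : v.length = w.length)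
    (hne : v ≠ w) {x y : Gasket} (h : cellMap v x = cellMap w y) : x ∈ Set.range vertex := by
  induction v generalizing w with
  | nil =>
    rw [List.length_nil] at hl
    exact absurd (List.length_eq_zero_iff.1 hl.symm).symm hne
  | cons i v ih =>
    cases w with
    | nil => simp at hl
    | cons j w =>
      by_cases hij : i = j
      · subst hij
        exact ih (by simpa using hl) (by simpa using hne) (F_injective i h)
      · exact ⟨j, (eq_vertex_of_cellMap_eq_vertex (eq_vertex_of_F_eq hij h)).1.symm⟩

/-! ### Words of a fixed length and the bounded overlap of cells -/

theorem sum_words_succ {M : Type*} [AddCommMonoid M] (m : ℕ) (f : List (Fin 3) → M) :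
    ∑ w : Fin (m + 1) → Fin 3, f (List.ofFn w) =
      ∑ k : Fin 3, ∑ w : Fin m → Fin 3, f (k :: List.ofFn w) := by
  rw [← (Fin.consEquiv (fun _ => Fin 3)).sum_comp, Fintype.sum_prod_type]
  refine Finset.sum_congr rfl fun k _ => Finset.sum_congr rfl fun w _ => ?_
  rw [show List.ofFn (Fin.consEquiv (fun _ => Fin 3) (k, w)) = k :: List.ofFn w from
    List.ofFn_cons k w]

theorem sum_words_indicator_F (m : ℕ) (k : Fin 3) (x : Gasket) :
    ∑ w : Fin m → Fin 3, (cell (k :: List.ofFn w)).indicator (1 : Gasket → ℝ≥0∞) (F k x) =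
      ∑ w : Fin m → Fin 3, (cell (List.ofFn w)).indicator (1 : Gasket → ℝ≥0∞) x := by
  refine Finset.sum_congr rfl fun w _ => ?_
  have : F k x ∈ cell (k :: List.ofFn w) ↔ x ∈ cell (List.ofFn w) := by
    constructor
    · rintro ⟨y, hy⟩
      exact ⟨y, F_injective k hy⟩
    · rintro ⟨y, hy⟩
      exact ⟨y, congrArg (F k) hy⟩
  by_cases hx : x ∈ cell (List.ofFn w)
  · rw [Set.indicator_of_mem hx, Set.indicator_of_mem (this.2 hx)]; rfl
  · rw [Set.indicator_of_notMem hx, Set.indicator_of_notMem (mt this.1 hx)]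

theorem sum_words_indicator_of_notMem (m : ℕ) (k : Fin 3) {x : Gasket} (hx : x ∉ Set.range (F k)) :
    ∑ w : Fin m → Fin 3, (cell (k :: List.ofFn w)).indicator (1 : Gasket → ℝ≥0∞) x = 0 := by
  refine Finset.sum_eq_zero fun w _ => Set.indicator_of_notMem ?_ _
  rintro ⟨y, rfl⟩
  exact hx ⟨_, rfl⟩

/-- A corner is reached only through its own first letter, so it lies in a single cell of each
level. -/
theorem sum_words_indicator_vertex_le (m : ℕ) (j : Fin 3) :
    ∑ w : Fin m → Fin 3, (cell (List.ofFn w)).indicator (1 : Gasket → ℝ≥0∞) (vertex j) ≤ 1 := by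
  induction m with
  | zero => simp [cell, cellMap]
  | succ m ih =>
    rw [sum_words_succ m fun w => (cell w).indicator (1 : Gasket → ℝ≥0∞) (vertex j),
      Finset.sum_eq_single j]
    · have h := sum_words_indicator_F m j (vertex j)
      rw [F_vertex_self] at h
      rwa [h]
    · intro k _ hk
      refine sum_words_indicator_of_notMem m k ?_
      rintro ⟨y, hy⟩
      exact hk (eq_of_F_eq_vertex hy).1
    · simp

/-- Every point lies in at most three cells of a given level. -/
theorem sum_words_indicator_le (m : ℕ) (x : Gasket) :
    ∑ w : Fin m → Fin 3, (cell (List.ofFn w)).indicator (1 : Gasket → ℝ≥0∞) x ≤ 3 := by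
  induction m generalizing x with
  | zero =>
    simp [cell, cellMap]
  | succ m ih =>
    rw [sum_words_succ m fun w => (cell w).indicator (1 : Gasket → ℝ≥0∞) x]
    -- If some preimage of `x` is not a corner, the first letter is unique and induction applies.
    -- Otherwise all preimages are corners, and each of the three letters contributes at most `1`.
    by_cases h : ∃ k y, F k y = x ∧ y ∉ Set.range vertex
    · obtain ⟨k, y, rfl, hy⟩ := h
      rw [Finset.sum_eq_single k]
      · rw [sum_words_indicator_F]
        exact ih y
      · intro j _ hj
        refine sum_words_indicator_of_notMem m j ?_
        rintro ⟨z, hz⟩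
        exact hy ⟨j, (eq_vertex_of_F_eq hj.symm hz.symm).symm⟩
      · simp
    · push Not at h
      refine (Finset.sum_le_card_nsmul _ _ 1 fun k _ => ?_).trans (by simp)
      by_cases hk : x ∈ Set.range (F k)
      · obtain ⟨y, rfl⟩ := hk
        obtain ⟨j, rfl⟩ := h k y rfl
        rw [sum_words_indicator_F]
        exact sum_words_indicator_vertex_le m j
      · rw [sum_words_indicator_of_notMem m k hk]
        exact zero_le

theorem sum_words_lintegral_cell_le (μ : Measure Gasket) (m : ℕ) {f : Gasket → ℝ≥0∞}
    (hf : Measurable f) :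
    ∑ w : Fin m → Fin 3, ∫⁻ x in cell (List.ofFn w), f x ∂μ ≤ 3 * ∫⁻ x, f x ∂μ := by
  simp_rw [← lintegral_indicator (measurableSet_cell _)]
  rw [← lintegral_finsetSum _ fun w _ => hf.indicator (measurableSet_cell _),
    ← lintegral_const_mul _ hf]
  refine lintegral_mono fun x => ?_
  calc ∑ w : Fin m → Fin 3, (cell (List.ofFn w)).indicator f x
      = (∑ w : Fin m → Fin 3, (cell (List.ofFn w)).indicator 1 x) * f x := by
        rw [Finset.sum_mul]
        refine Finset.sum_congr rfl fun w _ => ?_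
        by_cases hx : x ∈ cell (List.ofFn w) <;> simp [hx]
    _ ≤ 3 * f x := by gcongr; exact sum_words_indicator_le m x

theorem lintegral_le_sum_words (μ : Measure Gasket) (m : ℕ) (f : Gasket → ℝ≥0∞) :
    ∫⁻ x, f x ∂μ ≤ ∑ w : Fin m → Fin 3, ∫⁻ x in cell (List.ofFn w), f x ∂μ := by
  have hcover : (⋃ w : Fin m → Fin 3, cell (List.ofFn w)) = Set.univ :=
    Set.eq_univ_of_forall fun x => Set.mem_iUnion.2 (exists_mem_cell m x)
  rw [← setLIntegral_univ, ← hcover]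
  refine (lintegral_iUnion_le _ _).trans ?_
  rw [tsum_fintype]

end SierpinskiGasket

namespace SierpinskiGasket

/-! ### Self-similarity of the energy and the oscillation estimate -/

theorem levelEnergy_nonneg (m : ℕ) (u : Gasket → ℝ) : 0 ≤ levelEnergy m u := by
  unfold levelEnergy; positivity

theorem monotone_ofReal_levelEnergy (u : Gasket → ℝ) :
    Monotone fun m => ENNReal.ofReal (levelEnergy m u) :=
  monotone_nat_of_le_succ fun m => ENNReal.ofReal_le_ofReal (levelEnergy_le_succ m u)

theorem energy_eq_sum_F (u : Gasket → ℝ) :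
    energy u = ∑ k, ENNReal.ofReal (5 / 3) * energy (u ∘ F k) := by
  have h1 : energy u = ⨆ m, ENNReal.ofReal (levelEnergy (m + 1) u) :=
    ((monotone_ofReal_levelEnergy u).iSup_nat_add 1).symm
  rw [h1]
  simp_rw [energy, ENNReal.mul_iSup]
  rw [ENNReal.finsetSum_iSup_of_monotone fun k =>
    (monotone_ofReal_levelEnergy (u ∘ F k)).const_mul zero_le]
  refine iSup_congr fun m => ?_
  rw [levelEnergy_succ, ENNReal.ofReal_sum_of_nonneg fun k _ =>
    mul_nonneg (by norm_num) (levelEnergy_nonneg _ _)]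
  refine Finset.sum_congr rfl fun k _ => ?_
  rw [ENNReal.ofReal_mul (by norm_num)]

theorem energy_eq_sum_words (m : ℕ) (u : Gasket → ℝ) :
    energy u = ∑ w : Fin m → Fin 3,
      ENNReal.ofReal (5 / 3) ^ m * energy (u ∘ cellMap (List.ofFn w)) := by
  induction m generalizing u with
  | zero => simp [cellMap]
  | succ m ih =>
    rw [sum_words_succ m fun w => ENNReal.ofReal (5 / 3) ^ (m + 1) * energy (u ∘ cellMap w),
      energy_eq_sum_F]
    refine Finset.sum_congr rfl fun k _ => ?_
    rw [ih (u ∘ F k), Finset.mul_sum]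
    refine Finset.sum_congr rfl fun w _ => ?_
    rw [← mul_assoc, pow_succ']
    rfl

theorem ofReal_edge_le_energy (u : Gasket → ℝ) (w : List (Fin 3)) (i j : Fin 3) :
    ENNReal.ofReal ((5 / 3) ^ w.length *
      (u (cellMap w (vertex i)) - u (cellMap w (vertex j))) ^ 2) ≤ energy u := by
  refine le_trans (ENNReal.ofReal_le_ofReal ?_)
    (le_iSup (fun m => ENNReal.ofReal (levelEnergy m u)) w.length)
  by_cases hij : i = j
  · simpa [hij] using levelEnergy_nonneg _ _
  have hw : List.ofFn w.get = w := List.ofFn_get w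
  have hpos : ∀ (v : Fin w.length → Fin 3) (i j : Fin 3), 0 ≤ (1 / 2 : ℝ) * (5 / 3) ^ w.length *
      (u (cellMap (List.ofFn v) (vertex i)) - u (cellMap (List.ofFn v) (vertex j))) ^ 2 :=
    fun _ _ _ => by positivity
  unfold levelEnergy
  refine le_trans ?_ (Finset.single_le_sum (f := fun v : Fin w.length → Fin 3 => ∑ i, ∑ j,
    (1 / 2 : ℝ) * (5 / 3) ^ w.length * (u (cellMap (List.ofFn v) (vertex i)) -
      u (cellMap (List.ofFn v) (vertex j))) ^ 2)
    (fun v _ => Finset.sum_nonneg fun i _ => Finset.sum_nonneg fun j _ => hpos v i j)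
    (Finset.mem_univ w.get))
  rw [hw, ← Finset.sum_product']
  -- The two ordered pairs of the same edge together cancel the factor `1/2`.
  refine le_trans (le_of_eq ?_) (Finset.sum_le_sum_of_subset_of_nonneg
    (Finset.subset_univ {(i, j), (j, i)}) fun _ _ _ => by positivity)
  rw [Finset.sum_pair (by simp [hij])]
  ring

theorem code_truncate (n : ℕ) (ω : ℕ → Fin 3) :
    code (fun k => if k < n then ω k else 0) =
      cellMap (List.ofFn fun k : Fin n => ω k) (vertex 0) := by
  induction n generalizing ω with
  | zero => simpa [cellMap] using code_const 0
  | succ n ih =>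
    rw [code_eq, List.ofFn_succ, cellMap, Function.comp_apply]
    simpa using congrArg (F (ω 0)) (ih fun k => ω (k + 1))

theorem tendsto_code_truncate (ω : ℕ → Fin 3) :
    Tendsto (fun n => code (fun k => if k < n then ω k else 0)) atTop (𝓝 (code ω)) := by
  refine (continuous_code.tendsto ω).comp (tendsto_pi_nhds.2 fun k => ?_)
  refine tendsto_const_nhds.congr' ?_
  filter_upwards [eventually_gt_atTop k] with n hn
  simp [hn]

/-- The oscillation of a continuous function is controlled by its energy. -/
theorem abs_sub_vertex_le {u : Gasket → ℝ} (hu : Continuous u) (hE : energy u ≠ ∞) (x : Gasket) :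
    |u (vertex 0) - u x| ≤ 7 / 2 * √(energy u).toReal := by
  obtain ⟨ω, rfl⟩ := code_surjective x
  have hedge : ∀ (w : List (Fin 3)) (i j : Fin 3),
      |u (cellMap w (vertex i)) - u (cellMap w (vertex j))| ≤
        √(energy u).toReal * (7 / 9) ^ w.length := by
    intro w i j
    have h := (ENNReal.ofReal_le_iff_le_toReal hE).1 (ofReal_edge_le_energy u w i j)
    refine abs_le_of_sq_le_sq ?_ (by positivity)
    rw [mul_pow, Real.sq_sqrt ENNReal.toReal_nonneg, ← pow_mul, mul_comm _ 2, pow_mul]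
    -- `7/9` is a rational upper bound for `√(3/5)`; the geometric series of the steps then sums to
    -- `(7/9)/(1 - 7/9) = 7/2`.
    have h1 : (3 / 5 : ℝ) ^ w.length ≤ ((7 / 9) ^ 2) ^ w.length :=
      pow_le_pow_left₀ (by norm_num) (by norm_num) _
    have h2 : (3 / 5 : ℝ) ^ w.length * (5 / 3) ^ w.length = 1 := by
      rw [← mul_pow]; norm_num
    calc (u (cellMap w (vertex i)) - u (cellMap w (vertex j))) ^ 2
        = (3 / 5 : ℝ) ^ w.length * ((5 / 3) ^ w.length *
          (u (cellMap w (vertex i)) - u (cellMap w (vertex j))) ^ 2) := by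
          rw [← mul_assoc, h2, one_mul]
      _ ≤ (3 / 5 : ℝ) ^ w.length * (energy u).toReal := by gcongr
      _ ≤ ((7 / 9) ^ 2) ^ w.length * (energy u).toReal := by gcongr
      _ = _ := mul_comm _ _
  have hstep : ∀ n, dist (u (code fun k => if k < n then ω k else 0))
      (u (code fun k => if k < n + 1 then ω k else 0)) ≤
        (√(energy u).toReal * (7 / 9)) * (7 / 9) ^ n := by
    intro n
    -- Consecutive truncations of `ω` code the points `F_w(vertex 0)` and `F_w F_{ω n}(vertex 0) =
    -- F_w F_0 (vertex (ω n))`. Both are corners of the cell of the word `w0`, of level `n + 1`.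
    have h := hedge ((List.ofFn fun k : Fin n => ω k) ++ [0]) 0 (ω n)
    rw [cellMap_append] at h
    simp only [cellMap, Function.comp_apply, id, F_vertex_self, F_vertex_comm 0 (ω n),
      List.length_append, List.length_ofFn, List.length_singleton] at h
    rw [Real.dist_eq, code_truncate, code_truncate, List.ofFn_succ', List.concat_eq_append,
      cellMap_append]
    simp only [cellMap, Function.comp_apply, id, Fin.val_castSucc, Fin.val_last]
    refine h.trans (le_of_eq ?_)
    ring
  have h := dist_le_of_le_geometric_of_tendsto₀ (7 / 9) _ (by norm_num) hstep
    ((hu.tendsto _).comp (tendsto_code_truncate ω))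
  simp only [not_lt_zero, if_false, code_const, Real.dist_eq] at h
  refine h.trans (le_of_eq ?_)
  ring

theorem abs_sub_le_energy {u : Gasket → ℝ} (hu : Continuous u) (hE : energy u ≠ ∞)
    (x y : Gasket) : |u x - u y| ≤ 7 * √(energy u).toReal := by
  have hx := abs_sub_vertex_le hu hE x
  have hy := abs_sub_vertex_le hu hE y
  have h := abs_sub_le (u x) (u (vertex 0)) (u y)
  rw [abs_sub_comm (u x) (u (vertex 0))] at h
  linarith

theorem enorm_sub_le_energy {u : Gasket → ℝ} (hu : Continuous u) (x y : Gasket) :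
    ‖u x - u y‖ₑ ≤ 7 * energy u ^ (1 / 2 : ℝ) := by
  by_cases hE : energy u = ∞
  · rw [hE, ENNReal.top_rpow_of_pos (by norm_num), ENNReal.mul_top (by norm_num)]
    exact le_top
  · have h := ENNReal.ofReal_le_ofReal (abs_sub_le_energy hu hE x y)
    rw [ENNReal.ofReal_mul (by norm_num), Real.sqrt_eq_rpow,
      ← ENNReal.ofReal_rpow_of_nonneg ENNReal.toReal_nonneg (by norm_num),
      ENNReal.ofReal_toReal hE] at h
    rw [Real.enorm_eq_ofReal_abs]
    simpa using h

theorem levelEnergy_sub_const (m : ℕ) (u : Gasket → ℝ) (c : ℝ) :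
    levelEnergy m (fun x => u x - c) = levelEnergy m u := by
  simp [levelEnergy]

theorem energy_sub_const (u : Gasket → ℝ) (c : ℝ) : energy (fun x => u x - c) = energy u := by
  simp [energy, levelEnergy_sub_const]

end SierpinskiGasket

/-! ### Sobolev inequalities -/

/-- The `ℓ^q`-norm decreases in `q`; the two-term case is iterated. -/
theorem ENNReal.sum_rpow_rpow_le {ι : Type*} (s : Finset ι) (f : ι → ℝ≥0∞) {p q : ℝ}
    (hp : 0 < p) (hpq : p ≤ q) :
    (∑ i ∈ s, f i ^ q) ^ (1 / q) ≤ (∑ i ∈ s, f i ^ p) ^ (1 / p) := by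
  have hq : 0 < q := hp.trans_le hpq
  induction s using Finset.cons_induction with
  | empty => simp [hp, hq]
  | cons i s hi ih =>
    rw [Finset.sum_cons, Finset.sum_cons]
    have h := ENNReal.rpow_add_rpow_le (f i) ((∑ i ∈ s, f i ^ p) ^ (1 / p)) hp hpq
    rw [← ENNReal.rpow_mul _ _ p, one_div_mul_cancel hp.ne', ENNReal.rpow_one] at h
    refine le_trans ?_ h
    gcongr
    calc ∑ i ∈ s, f i ^ q = ((∑ i ∈ s, f i ^ q) ^ (1 / q)) ^ q := by
          rw [← ENNReal.rpow_mul, one_div_mul_cancel hq.ne', ENNReal.rpow_one]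
      _ ≤ _ := by gcongr

namespace SierpinskiGasket

/-! ### The inequality at a fixed scale -/

theorem energy_comp_cellMap_le (m : ℕ) (w : Fin m → Fin 3) (v : Gasket → ℝ) :
    energy (v ∘ cellMap (List.ofFn w)) ≤ (ENNReal.ofReal (5 / 3) ^ m)⁻¹ * energy v := by
  have h0 : ENNReal.ofReal (5 / 3) ≠ 0 := by simp
  rw [← ENNReal.mul_le_iff_le_inv (by simp) (by finiteness), energy_eq_sum_words m v]
  exact Finset.single_le_sum (f := fun w : Fin m → Fin 3 =>
    ENNReal.ofReal (5 / 3) ^ m * energy (v ∘ cellMap (List.ofFn w))) (fun _ _ => zero_le)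
    (Finset.mem_univ w)

theorem sum_energy_comp_cellMap (m : ℕ) (v : Gasket → ℝ) :
    ∑ w : Fin m → Fin 3, energy (v ∘ cellMap (List.ofFn w)) =
      (ENNReal.ofReal (5 / 3) ^ m)⁻¹ * energy v := by
  have h0 : ENNReal.ofReal (5 / 3) ≠ 0 := by simp
  rw [energy_eq_sum_words m v, ← Finset.mul_sum, ← mul_assoc,
    ENNReal.inv_mul_cancel (by simp) (by finiteness), one_mul]

/-- On a cell, a function is bounded by its local energy and its local `L^p`-norm. -/
theorem enorm_le_of_mem_cell {μ : Measure Gasket} [IsFiniteMeasure μ] {v : Gasket → ℝ}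
    (hv : Continuous v) {p : ℝ≥0∞} (hp : p ≠ 0) {w : List (Fin 3)} {L : ℝ≥0∞}
    (hL : L⁻¹ ≤ μ (cell w)) (hL' : L ≠ ∞) {x : Gasket} (hx : x ∈ cell w) :
    ‖v x‖ₑ ≤ 7 * energy (v ∘ cellMap w) ^ (1 / 2 : ℝ) +
      L ^ (1 / p.toReal) * eLpNorm v p (μ.restrict (cell w)) := by
  set O := 7 * energy (v ∘ cellMap w) ^ (1 / 2 : ℝ)
  -- With truncated subtraction, `t` is a lower bound for `|v|` on the whole cell, so its constant
  -- `L^p`-norm over the cell is at most the local norm of `v`.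
  set t := ‖v x‖ₑ - O
  rw [← tsub_le_iff_left]
  change t ≤ _
  have hμ0 : μ (cell w) ≠ 0 := fun h => by simp [h, hL'] at hL
  have hμt : μ (cell w) ≠ ∞ := measure_ne_top _ _
  have hμr : μ.restrict (cell w) ≠ 0 := by rwa [Ne, Measure.restrict_eq_zero]
  have hle : eLpNorm (fun _ : Gasket => t) p (μ.restrict (cell w)) ≤
      eLpNorm v p (μ.restrict (cell w)) := by
    refine eLpNorm_mono_enorm_ae ?_
    filter_upwards [ae_restrict_mem (measurableSet_cell w)] with y hy
    obtain ⟨x', rfl⟩ := hx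
    obtain ⟨y', rfl⟩ := hy
    have h := enorm_sub_le_energy (hv.comp (continuous_cellMap w)) x' y'
    rw [enorm_eq_self, tsub_le_iff_left]
    calc ‖v (cellMap w x')‖ₑ
        = ‖(v (cellMap w x') - v (cellMap w y')) + v (cellMap w y')‖ₑ := by rw [sub_add_cancel]
      _ ≤ _ := (enorm_add_le (v (cellMap w x') - v (cellMap w y')) _).trans (by gcongr; exact h)
  rw [eLpNorm_const _ hp hμr, Measure.restrict_apply_univ, enorm_eq_self] at hle
  have hexp : 0 ≤ 1 / p.toReal := by positivity
  calc t = t * (μ (cell w) ^ (1 / p.toReal) * (μ (cell w))⁻¹ ^ (1 / p.toReal)) := by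
        rw [← ENNReal.mul_rpow_of_nonneg _ _ hexp, ENNReal.mul_inv_cancel hμ0 hμt,
          ENNReal.one_rpow, mul_one]
    _ = (μ (cell w))⁻¹ ^ (1 / p.toReal) * (t * μ (cell w) ^ (1 / p.toReal)) := by ring
    _ ≤ _ := by
        gcongr
        exact ENNReal.inv_le_iff_inv_le.1 hL

/-- The Sobolev inequality at a fixed scale, for the supremum norm. -/
theorem eLpNorm_top_le_scale {μ₁ μ₂ : Measure Gasket} [IsFiniteMeasure μ₂] {v : Gasket → ℝ}
    (hv : Continuous v) {p : ℝ≥0∞} (hp : p ≠ 0) (m : ℕ) {L : ℝ≥0∞} (hL' : L ≠ ∞)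
    (hL : ∀ w : Fin m → Fin 3, L⁻¹ ≤ μ₂ (cell (List.ofFn w))) :
    eLpNorm v ∞ μ₁ ≤ 7 * ((ENNReal.ofReal (5 / 3) ^ m)⁻¹ * energy v) ^ (1 / 2 : ℝ) +
      L ^ (1 / p.toReal) * eLpNorm v p μ₂ := by
  rw [eLpNorm_exponent_top]
  refine eLpNormEssSup_le_of_ae_enorm_bound (Eventually.of_forall fun x => ?_)
  obtain ⟨w, hw⟩ := exists_mem_cell m x
  refine (enorm_le_of_mem_cell hv hp (hL w) hL' hw).trans ?_
  gcongr
  · exact energy_comp_cellMap_le m w v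
  · exact Measure.restrict_le_self

/-- The Sobolev inequality at a fixed scale, for finite exponents. -/
theorem eLpNorm_le_scale {μ₁ μ₂ : Measure Gasket} [IsFiniteMeasure μ₂] {v : Gasket → ℝ}
    (hv : Continuous v) {p q : ℝ≥0∞} (hp : 1 ≤ p) (hpq : p ≤ q) (hq2 : 2 ≤ q) (hq : q ≠ ∞) (m : ℕ)
    {L U : ℝ≥0∞} (hL' : L ≠ ∞) (hL : ∀ w : Fin m → Fin 3, L⁻¹ ≤ μ₂ (cell (List.ofFn w)))
    (hU : ∀ w : Fin m → Fin 3, μ₁ (cell (List.ofFn w)) ≤ U) :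
    eLpNorm v q μ₁ ≤ U ^ (1 / q.toReal) *
      (7 * ((ENNReal.ofReal (5 / 3) ^ m)⁻¹ * energy v) ^ (1 / 2 : ℝ) +
        (3 * L) ^ (1 / p.toReal) * eLpNorm v p μ₂) := by
  have hpt : p ≠ ∞ := ne_top_of_le_ne_top hq hpq
  have hp0 : p ≠ 0 := (zero_lt_one.trans_le hp).ne'
  have hq0 : q ≠ 0 := (zero_lt_two.trans_le hq2).ne'
  have hpr : 0 < p.toReal := ENNReal.toReal_pos hp0 hpt
  have hqr2 : 2 ≤ q.toReal := by simpa using ENNReal.toReal_mono hq hq2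
  have hqr : 0 < q.toReal := by linarith
  have hpqr : p.toReal ≤ q.toReal := ENNReal.toReal_mono hq hpq
  have hvm : Measurable fun x => ‖v x‖ₑ := hv.measurable.enorm
  set A : (Fin m → Fin 3) → ℝ≥0∞ := fun w =>
    7 * energy (v ∘ cellMap (List.ofFn w)) ^ (1 / 2 : ℝ) with hA
  set B : (Fin m → Fin 3) → ℝ≥0∞ := fun w =>
    L ^ (1 / p.toReal) * eLpNorm v p (μ₂.restrict (cell (List.ofFn w))) with hB
  have hAsum : (∑ w, A w ^ q.toReal) ^ (1 / q.toReal) ≤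
      7 * ((ENNReal.ofReal (5 / 3) ^ m)⁻¹ * energy v) ^ (1 / 2 : ℝ) := by
    -- This is where `2 ≤ q` enters: energies are additive over cells, so oscillations are summed in
    -- `ℓ²`.
    refine (ENNReal.sum_rpow_rpow_le _ A two_pos hqr2).trans (le_of_eq ?_)
    have h1 : ∀ w, A w ^ (2 : ℝ) = 7 ^ (2 : ℝ) * energy (v ∘ cellMap (List.ofFn w)) := by
      intro w
      rw [hA, ENNReal.mul_rpow_of_nonneg _ _ two_pos.le, ← ENNReal.rpow_mul]
      norm_num
    simp_rw [h1]
    rw [← Finset.mul_sum, sum_energy_comp_cellMap, ENNReal.mul_rpow_of_nonneg _ _ (by norm_num),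
      ← ENNReal.rpow_mul]
    norm_num
  have hBsum : (∑ w, B w ^ q.toReal) ^ (1 / q.toReal) ≤
      (3 * L) ^ (1 / p.toReal) * eLpNorm v p μ₂ := by
    -- Here `p ≤ q` enters; the factor `3` in `3 * L` pays for overlaps, which `μ₂` may charge.
    refine (ENNReal.sum_rpow_rpow_le _ B hpr hpqr).trans ?_
    have h1 : ∀ w, B w ^ p.toReal =
        L * ∫⁻ x in cell (List.ofFn w), ‖v x‖ₑ ^ p.toReal ∂μ₂ := by
      intro w
      rw [hB, ENNReal.mul_rpow_of_nonneg _ _ hpr.le, ← ENNReal.rpow_mul,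
        one_div_mul_cancel hpr.ne', ENNReal.rpow_one,
        eLpNorm_eq_lintegral_rpow_enorm_toReal hp0 hpt, ← ENNReal.rpow_mul,
        one_div_mul_cancel hpr.ne', ENNReal.rpow_one]
    simp_rw [h1]
    rw [← Finset.mul_sum, eLpNorm_eq_lintegral_rpow_enorm_toReal hp0 hpt,
      ← ENNReal.mul_rpow_of_nonneg _ _ (by positivity), mul_comm 3 L, mul_assoc]
    gcongr
    exact sum_words_lintegral_cell_le μ₂ m (hvm.pow_const _)
  calc eLpNorm v q μ₁
      = (∫⁻ x, ‖v x‖ₑ ^ q.toReal ∂μ₁) ^ (1 / q.toReal) :=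
        eLpNorm_eq_lintegral_rpow_enorm_toReal hq0 hq
    _ ≤ (∑ w, U * (A w + B w) ^ q.toReal) ^ (1 / q.toReal) := by
        gcongr
        refine (lintegral_le_sum_words μ₁ m _).trans (Finset.sum_le_sum fun w _ => ?_)
        calc ∫⁻ x in cell (List.ofFn w), ‖v x‖ₑ ^ q.toReal ∂μ₁
            ≤ ∫⁻ x in cell (List.ofFn w), (A w + B w) ^ q.toReal ∂μ₁ := by
              refine setLIntegral_mono' (measurableSet_cell _) fun x hx => ?_
              gcongr
              exact enorm_le_of_mem_cell hv hp0 (hL w) hL' hx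
          _ ≤ U * (A w + B w) ^ q.toReal := by
              rw [setLIntegral_const, mul_comm]
              gcongr
              exact hU w
    _ = U ^ (1 / q.toReal) * (∑ w, (A w + B w) ^ q.toReal) ^ (1 / q.toReal) := by
        rw [← Finset.mul_sum, ENNReal.mul_rpow_of_nonneg _ _ (by positivity)]
    _ ≤ U ^ (1 / q.toReal) * ((∑ w, A w ^ q.toReal) ^ (1 / q.toReal) +
          (∑ w, B w ^ q.toReal) ^ (1 / q.toReal)) := by
        gcongr
        exact ENNReal.Lp_add_le _ _ _ (by linarith)
    _ ≤ _ := by gcongr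

end SierpinskiGasket

/-- Optimising `3^{-m(s+g)} e + 3^{m(t-s)} P` over the scale `m`. -/
theorem interpolation_of_scales {N D e P s t g : ℝ} (hD : 0 ≤ D) (hP : 0 < P) (hPe : P ≤ e)
    (hs : 0 ≤ s) (hs1 : s ≤ 1) (hst : s ≤ t) (hg : 0 < g) (hg1 : g ≤ 1)
    (h : ∀ m : ℕ, N ≤ D * (3 ^ (-(m * (s + g))) * e + 3 ^ (m * (t - s)) * P)) :
    N ≤ 10 * D * (e ^ ((t - s) / (t + g)) * P ^ (1 - (t - s) / (t + g))) := by
  have he : 0 < e := hP.trans_le hPe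
  have htg : 0 < t + g := by linarith
  set a := (t - s) / (t + g) with ha
  -- The real scale at which both terms are equal: `3^{τ(t+g)} = e/P`. It is nonnegative because `P
  -- ≤ e`.
  set τ := Real.logb 3 (e / P) / (t + g) with hτ
  have hτ0 : 0 ≤ τ := div_nonneg (Real.logb_nonneg (by norm_num) ((one_le_div hP).2 hPe)) htg.le
  have h3 : (3 : ℝ) ^ (τ * (t + g)) = e / P := by
    rw [hτ, div_mul_cancel₀ _ htg.ne', Real.rpow_logb (by norm_num) (by norm_num) (by positivity)]
  have hprod : (e / P) ^ a * P = e ^ a * P ^ (1 - a) := by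
    rw [Real.div_rpow he.le hP.le, Real.rpow_sub hP, Real.rpow_one]
    field_simp
  have h1a : (1 - a) * (t + g) = s + g := by
    rw [ha]; field_simp; ring
  have haa : a * (t + g) = t - s := by rw [ha]; field_simp
  have hprod' : (e / P) ^ (-(1 - a)) * e = e ^ a * P ^ (1 - a) := by
    rw [Real.rpow_neg (by positivity), Real.div_rpow he.le hP.le, Real.rpow_sub he, Real.rpow_one]
    field_simp
  have hm := Nat.floor_le hτ0
  have hm' := (Nat.lt_floor_add_one τ).le
  have e1 : (3 : ℝ) ^ (-((⌊τ⌋₊ : ℝ) * (s + g))) * e ≤ 9 * (e ^ a * P ^ (1 - a)) := by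
    calc (3 : ℝ) ^ (-((⌊τ⌋₊ : ℝ) * (s + g))) * e
        ≤ (3 : ℝ) ^ ((2 : ℝ) + (τ * (t + g)) * (-(1 - a))) * e := by
          gcongr
          · norm_num
          · have : (τ - ⌊τ⌋₊) * (s + g) ≤ 1 * 2 := by
              apply mul_le_mul <;> linarith
            nlinarith
      _ = 9 * ((e / P) ^ (-(1 - a)) * e) := by
          rw [Real.rpow_add (by norm_num), Real.rpow_mul (by norm_num), h3]
          norm_num [mul_assoc]
      _ = _ := by rw [hprod']
  have e2 : (3 : ℝ) ^ ((⌊τ⌋₊ : ℝ) * (t - s)) * P ≤ e ^ a * P ^ (1 - a) := by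
    calc (3 : ℝ) ^ ((⌊τ⌋₊ : ℝ) * (t - s)) * P
        ≤ (3 : ℝ) ^ (τ * (t - s)) * P := by
          have : 0 ≤ t - s := by linarith
          gcongr
          norm_num
      _ = (3 : ℝ) ^ ((τ * (t + g)) * a) * P := by rw [← haa]; ring_nf
      _ = (e / P) ^ a * P := by rw [Real.rpow_mul (by norm_num), h3]
      _ = _ := hprod
  calc N ≤ D * (3 ^ (-((⌊τ⌋₊ : ℝ) * (s + g))) * e + 3 ^ ((⌊τ⌋₊ : ℝ) * (t - s)) * P) := h _
    _ ≤ D * (9 * (e ^ a * P ^ (1 - a)) + e ^ a * P ^ (1 - a)) := by gcongr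
    _ = _ := by ring

/-- The degenerate case `P = 0`, in which no scale balances the terms and `m → ∞` is taken instead.
-/
theorem nonpos_of_scales {N D e s g : ℝ} (hsg : 0 < s + g)
    (h : ∀ m : ℕ, N ≤ D * (3 ^ (-(m * (s + g))) * e)) : N ≤ 0 := by
  have hlim : Tendsto (fun m : ℕ => D * ((3 : ℝ) ^ (-(m * (s + g))) * e)) atTop (𝓝 0) := by
    have h1 : Tendsto (fun m : ℕ => ((3 : ℝ) ^ (-(s + g))) ^ m) atTop (𝓝 0) :=
      tendsto_pow_atTop_nhds_zero_of_lt_one (by positivity)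
        (Real.rpow_lt_one_of_one_lt_of_neg (by norm_num) (by linarith))
    have h2 := (h1.mul_const e).const_mul D
    rw [zero_mul, mul_zero] at h2
    refine h2.congr fun m => ?_
    rw [← Real.rpow_mul_natCast (by norm_num)]
    congr 3
    ring
  exact ge_of_tendsto' hlim h

namespace SierpinskiGasket

/-! ### The spectral exponent and the scale inequality in powers of 3 -/

theorem two_deltaS_inv : 1 / (2 * deltaS) = (Real.log 5 / Real.log 3 - 1) / 2 := by
  rw [deltaS]
  field_simp

theorem two_deltaS_inv_pos : 0 < 1 / (2 * deltaS) := by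
  have h3 : 0 < Real.log 3 := Real.log_pos (by norm_num)
  have : 1 < Real.log 5 / Real.log 3 := by
    rw [one_lt_div h3]
    exact Real.log_lt_log (by norm_num) (by norm_num)
  rw [two_deltaS_inv]
  linarith

theorem two_deltaS_inv_le_one : 1 / (2 * deltaS) ≤ 1 := by
  have h3 : 0 < Real.log 3 := Real.log_pos (by norm_num)
  have : Real.log 5 / Real.log 3 ≤ 3 := by
    rw [div_le_iff₀ h3, ← Real.log_rpow (by norm_num)]
    exact Real.log_le_log (by norm_num) (by norm_num)
  rw [two_deltaS_inv]
  linarith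

/-- The reason for `δ_s`: the energy gain `(3/5)^{m/2}` on a cell of level `m` is exactly
`ν(𝕊_w)^{1/(2δ_s)}`. -/
theorem three_rpow_two_deltaS_inv : (3 : ℝ) ^ (1 / (2 * deltaS)) = (5 / 3) ^ (1 / 2 : ℝ) := by
  have h3 : Real.log 3 ≠ 0 := (Real.log_pos (by norm_num)).ne'
  rw [Real.rpow_def_of_pos (by norm_num), Real.rpow_def_of_pos (by norm_num), two_deltaS_inv,
    Real.log_div (by norm_num) (by norm_num)]
  congr 1
  field_simp

theorem inv_pow_rpow_half (m : ℕ) :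
    ((ENNReal.ofReal (5 / 3) ^ m)⁻¹) ^ (1 / 2 : ℝ) =
      ENNReal.ofReal (3 ^ (-(m * (1 / (2 * deltaS))))) := by
  rw [← ENNReal.ofReal_pow (by norm_num), ← ENNReal.ofReal_inv_of_pos (by positivity),
    ENNReal.ofReal_rpow_of_pos (by positivity)]
  congr 1
  rw [Real.rpow_neg (by norm_num), mul_comm (m : ℝ), Real.rpow_mul (by norm_num),
    three_rpow_two_deltaS_inv, Real.inv_rpow (by positivity), Real.rpow_natCast, ← Real.rpow_natCast,
    ← Real.rpow_natCast, ← Real.rpow_mul (by norm_num), ← Real.rpow_mul (by norm_num), mul_comm]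

theorem inv_pow_rpow (m : ℕ) (x : ℝ) :
    ((3⁻¹ : ℝ≥0∞) ^ m) ^ x = ENNReal.ofReal (3 ^ (-(m * x))) := by
  have : (3⁻¹ : ℝ≥0∞) = ENNReal.ofReal (3⁻¹) := by
    rw [ENNReal.ofReal_inv_of_pos (by norm_num)]; simp
  rw [this, ← ENNReal.ofReal_pow (by norm_num), ENNReal.ofReal_rpow_of_pos (by positivity)]
  congr 1
  rw [inv_pow, Real.inv_rpow (by positivity), Real.rpow_neg (by norm_num), ← Real.rpow_natCast,
    ← Real.rpow_mul (by norm_num)]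

theorem memLp_of_continuous {v : Gasket → ℝ} (hv : Continuous v) (p : ℝ≥0∞)
    (μ : Measure Gasket) [IsFiniteMeasure μ] : MemLp v p μ := by
  obtain ⟨C, hC⟩ := isCompact_univ.exists_bound_of_continuousOn hv.continuousOn
  exact MemLp.of_bound hv.aestronglyMeasurable C (Eventually.of_forall fun x => hC x trivial)

/-- Removes the powers `1/p` and `1/q` from the constants, which makes the final constant
independent of `p` and `q`. -/
theorem rpow_one_div_toReal_le {x y : ℝ≥0∞} (hy : 1 ≤ y) (hxy : x ≤ y) {p : ℝ≥0∞} (hp : 1 ≤ p) :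
    x ^ (1 / p.toReal) ≤ y := by
  have h1 : 1 / p.toReal ≤ 1 := by
    by_cases hpt : p = ∞
    · simp [hpt]
    · have := ENNReal.toReal_mono hpt hp
      rw [ENNReal.toReal_one] at this
      exact div_le_one_of_le₀ this (by linarith)
  calc x ^ (1 / p.toReal) ≤ y ^ (1 / p.toReal) := by gcongr
    _ ≤ y ^ (1 : ℝ) := ENNReal.rpow_le_rpow_of_exponent_le hy h1
    _ = y := ENNReal.rpow_one y

/-- The Sobolev inequality at scale `m`. -/
theorem toReal_eLpNorm_le_scale {μ₁ μ₂ : Measure Gasket} [IsFiniteMeasure μ₁] [IsFiniteMeasure μ₂]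
    {K : ℝ≥0} (hK : 1 ≤ K) {α β : ℝ}
    (hU : ∀ w : List (Fin 3), μ₁ (cell w) ≤ K * nu (cell w) ^ α)
    (hL : ∀ w : List (Fin 3), (K : ℝ≥0∞)⁻¹ * nu (cell w) ^ β ≤ μ₂ (cell w))
    {v : Gasket → ℝ} (hv : Continuous v) (hE : energy v ≠ ∞)
    {p q : ℝ≥0∞} (hp : 1 ≤ p) (hpq : p ≤ q) (hq2 : 2 ≤ q) (m : ℕ) :
    (eLpNorm v q μ₁).toReal ≤ 7 * K ^ 2 *
      (3 ^ (-(m * (α / q.toReal + 1 / (2 * deltaS)))) * (energy v ^ (1 / 2 : ℝ)).toReal +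
        3 ^ (m * (β / p.toReal - α / q.toReal)) * (eLpNorm v p μ₂).toReal) := by
  have hp0 : p ≠ 0 := (zero_lt_one.trans_le hp).ne'
  have hK0 : (K : ℝ≥0∞) ≠ 0 := by
    rw [Ne, ENNReal.coe_eq_zero]; exact (zero_lt_one.trans_le hK).ne'
  have hK1 : (1 : ℝ≥0∞) ≤ K := by exact_mod_cast hK
  set e := energy v ^ (1 / 2 : ℝ)
  have he : e ≠ ∞ := ENNReal.rpow_ne_top_of_nonneg (by norm_num) hE
  set P := eLpNorm v p μ₂
  have hP : P ≠ ∞ := (memLp_of_continuous hv p μ₂).eLpNorm_ne_top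
  set L : ℝ≥0∞ := K * ENNReal.ofReal (3 ^ (m * β)) with hLdef
  set U : ℝ≥0∞ := K * ENNReal.ofReal (3 ^ (-(m * α))) with hUdef
  have hL' : ∀ w : Fin m → Fin 3, L⁻¹ ≤ μ₂ (cell (List.ofFn w)) := by
    intro w
    refine le_trans (le_of_eq ?_) (hL _)
    rw [nu_cell, List.length_ofFn, inv_pow_rpow, Real.rpow_neg (by norm_num),
      ENNReal.ofReal_inv_of_pos (by positivity), hLdef,
      ENNReal.mul_inv (Or.inl hK0) (Or.inl ENNReal.coe_ne_top)]
  have hU' : ∀ w : Fin m → Fin 3, μ₁ (cell (List.ofFn w)) ≤ U := by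
    intro w
    refine (hU _).trans (le_of_eq ?_)
    rw [nu_cell, List.length_ofFn, inv_pow_rpow]
  have hLt : L ≠ ∞ := ENNReal.mul_ne_top ENNReal.coe_ne_top ENNReal.ofReal_ne_top
  have main : eLpNorm v q μ₁ ≤ U ^ (1 / q.toReal) *
      (7 * ((ENNReal.ofReal (5 / 3) ^ m)⁻¹ * energy v) ^ (1 / 2 : ℝ) +
        (3 * L) ^ (1 / p.toReal) * P) := by
    by_cases hq : q = ∞
    · subst hq
      simp only [ENNReal.toReal_top, div_zero, ENNReal.rpow_zero, one_mul]
      refine (eLpNorm_top_le_scale hv hp0 m hLt hL').trans ?_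
      gcongr
      exact le_mul_of_one_le_left zero_le (by norm_num)
    · exact eLpNorm_le_scale hv hp hpq hq2 hq m hLt hL' hU'
  have hUq : U ^ (1 / q.toReal) ≤ K * ENNReal.ofReal (3 ^ (-(m * (α / q.toReal)))) := by
    rw [hUdef, ENNReal.mul_rpow_of_nonneg _ _ (by positivity),
      ENNReal.ofReal_rpow_of_pos (by positivity), ← Real.rpow_mul (by norm_num),
      show -(m * α) * (1 / q.toReal) = -(m * (α / q.toReal)) by ring]
    gcongr
    exact rpow_one_div_toReal_le hK1 le_rfl (hp.trans hpq)
  have hLp : (3 * L) ^ (1 / p.toReal) ≤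
      3 * K * ENNReal.ofReal (3 ^ (m * (β / p.toReal))) := by
    rw [hLdef, ← mul_assoc, ENNReal.mul_rpow_of_nonneg _ _ (by positivity),
      ENNReal.ofReal_rpow_of_pos (by positivity), ← Real.rpow_mul (by norm_num),
      show m * β * (1 / p.toReal) = m * (β / p.toReal) by ring]
    gcongr
    refine rpow_one_div_toReal_le ?_ le_rfl hp
    exact hK1.trans (le_mul_of_one_le_left zero_le (by norm_num))
  have main' : eLpNorm v q μ₁ ≤ K * ENNReal.ofReal (3 ^ (-(m * (α / q.toReal)))) *
      (7 * (ENNReal.ofReal (3 ^ (-(m * (1 / (2 * deltaS))))) * e) +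
        3 * K * ENNReal.ofReal (3 ^ (m * (β / p.toReal))) * P) := by
    refine main.trans ?_
    rw [ENNReal.mul_rpow_of_nonneg _ _ (by norm_num : (0 : ℝ) ≤ 1 / 2), inv_pow_rpow_half]
    gcongr
  have h7 : 7 * (ENNReal.ofReal (3 ^ (-(m * (1 / (2 * deltaS))))) * e) ≠ ∞ := by finiteness
  have h8 : 3 * K * ENNReal.ofReal (3 ^ (m * (β / p.toReal))) * P ≠ ∞ := by finiteness
  have hr := ENNReal.toReal_mono (by finiteness) main'
  rw [ENNReal.toReal_mul, ENNReal.toReal_add h7 h8] at hr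
  simp only [ENNReal.toReal_mul, ENNReal.coe_toReal, ENNReal.toReal_ofNat] at hr
  rw [ENNReal.toReal_ofReal (by positivity), ENNReal.toReal_ofReal (by positivity),
    ENNReal.toReal_ofReal (by positivity)] at hr
  refine hr.trans ?_
  have hKr : (1 : ℝ) ≤ K := by exact_mod_cast hK
  rw [mul_add (m : ℝ), neg_add, Real.rpow_add (by norm_num), mul_sub (m : ℝ), sub_eq_neg_add,
    Real.rpow_add (by norm_num)]
  set A : ℝ := 3 ^ (-((m : ℝ) * (α / q.toReal)))
  set B : ℝ := 3 ^ (-((m : ℝ) * (1 / (2 * deltaS))))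
  set Γ : ℝ := 3 ^ ((m : ℝ) * (β / p.toReal))
  have hA : 0 ≤ A := by positivity
  have hB : 0 ≤ B := by positivity
  have hΓ : 0 ≤ Γ := by positivity
  -- The two terms carry the constants `7K` and `3K²`, and both are at most `7K²`.
  have h1 : (K : ℝ) * (A * B * e.toReal) ≤ (K : ℝ) ^ 2 * (A * B * e.toReal) := by
    gcongr
    exact le_self_pow₀ hKr (by norm_num)
  have h2 : 0 ≤ (K : ℝ) ^ 2 * (A * Γ * P.toReal) := by positivity
  nlinarith

end SierpinskiGasket

/-! ### From all scales to the multiplicative and the inhomogeneous inequality -/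

namespace SierpinskiGasket

theorem enorm_sub_const_le {u : Gasket → ℝ} (hu : Continuous u) {c : ℝ} (hc : ⨅ x, u x ≤ c)
    (hc' : c ≤ ⨆ x, u x) (x : Gasket) : ‖u x - c‖ₑ ≤ 7 * energy u ^ (1 / 2 : ℝ) := by
  obtain ⟨y, -, hy⟩ := isCompact_univ.exists_isMinOn Set.univ_nonempty hu.continuousOn
  obtain ⟨z, -, hz⟩ := isCompact_univ.exists_isMaxOn Set.univ_nonempty hu.continuousOn
  replace hc : u y ≤ c := (le_ciInf fun t => hy (Set.mem_univ t)).trans hc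
  replace hc' : c ≤ u z := hc'.trans (ciSup_le fun t => hz (Set.mem_univ t))
  rcases le_total c (u x) with h | h
  · refine le_trans ?_ (enorm_sub_le_energy hu x y)
    rw [Real.enorm_eq_ofReal_abs, Real.enorm_eq_ofReal_abs, abs_of_nonneg (by linarith),
      abs_of_nonneg (by linarith)]
    exact ENNReal.ofReal_le_ofReal (by linarith)
  · refine le_trans ?_ (enorm_sub_le_energy hu x z)
    rw [Real.enorm_eq_ofReal_abs, Real.enorm_eq_ofReal_abs, abs_of_nonpos (by linarith),
      abs_of_nonpos (by linarith)]
    exact ENNReal.ofReal_le_ofReal (by linarith)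

theorem eLpNorm_le_of_enorm_le {μ : Measure Gasket} {K : ℝ≥0} (hK : 1 ≤ K)
    (hμ : μ Set.univ ≤ K) {v : Gasket → ℝ} {M : ℝ≥0∞} (hM : ∀ x, ‖v x‖ₑ ≤ M)
    {q : ℝ≥0∞} (hq : 1 ≤ q) : eLpNorm v q μ ≤ K * M := by
  have hK1 : (1 : ℝ≥0∞) ≤ K := by exact_mod_cast hK
  have hq0 : q ≠ 0 := (zero_lt_one.trans_le hq).ne'
  rcases eq_or_ne μ 0 with rfl | hμ0
  · simp
  calc eLpNorm v q μ ≤ eLpNorm (fun _ : Gasket => M) q μ :=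
        eLpNorm_mono_enorm fun x => by simpa using hM x
    _ = M * μ Set.univ ^ (1 / q.toReal) := by rw [eLpNorm_const _ hq0 hμ0, enorm_eq_self]
    _ ≤ M * K := by
        gcongr
        exact rpow_one_div_toReal_le hK1 hμ hq
    _ = K * M := mul_comm _ _

section

variable {μ₁ μ₂ : Measure Gasket} [IsFiniteMeasure μ₁] [IsFiniteMeasure μ₂] {K : ℝ≥0}
  {α β : ℝ} {p q : ℝ≥0∞}

/-- The multiplicative Sobolev inequality when the `L^p`-norm is dominated by the energy. -/
theorem eLpNorm_le_of_le_energy (hK : 1 ≤ K) (hα : 0 ≤ α) (hα1 : α ≤ 1)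
    (hU : ∀ w : List (Fin 3), μ₁ (cell w) ≤ K * nu (cell w) ^ α)
    (hL : ∀ w : List (Fin 3), (K : ℝ≥0∞)⁻¹ * nu (cell w) ^ β ≤ μ₂ (cell w))
    (hp : 1 ≤ p) (hpq : p ≤ q) (hq2 : 2 ≤ q) (hst : α / q.toReal ≤ β / p.toReal)
    {v : Gasket → ℝ} (hv : Continuous v) (hE : energy v ≠ ∞)
    (hPE : eLpNorm v p μ₂ ≤ energy v ^ (1 / 2 : ℝ)) :
    eLpNorm v q μ₁ ≤ (70 * K ^ 2 : ℝ≥0) *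
      (energy v ^ ((β / p.toReal - α / q.toReal) / (β / p.toReal + 1 / (2 * deltaS)) / 2) *
        eLpNorm v p μ₂ ^
          (1 - (β / p.toReal - α / q.toReal) / (β / p.toReal + 1 / (2 * deltaS)))) := by
  have hscale := toReal_eLpNorm_le_scale hK hU hL hv hE hp hpq hq2
  set s := α / q.toReal
  set t := β / p.toReal
  set g := 1 / (2 * deltaS)
  have hg : 0 < g := two_deltaS_inv_pos
  have hg1 : g ≤ 1 := two_deltaS_inv_le_one
  have hs : 0 ≤ s := by positivity
  have hs1 : s ≤ 1 := by
    by_cases hq : q = ∞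
    · simp [s, hq]
    · have : 2 ≤ q.toReal := by simpa using ENNReal.toReal_mono hq hq2
      exact div_le_one_of_le₀ (by linarith) (by linarith)
  set a := (t - s) / (t + g)
  have hN : eLpNorm v q μ₁ ≠ ∞ := (memLp_of_continuous hv q μ₁).eLpNorm_ne_top
  have hP : eLpNorm v p μ₂ ≠ ∞ := (memLp_of_continuous hv p μ₂).eLpNorm_ne_top
  set N := eLpNorm v q μ₁
  set P := eLpNorm v p μ₂
  have he : energy v ^ (1 / 2 : ℝ) ≠ ∞ := ENNReal.rpow_ne_top_of_nonneg (by norm_num) hE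
  have hea : energy v ^ (a / 2) = (energy v ^ (1 / 2 : ℝ)) ^ a := by
    rw [← ENNReal.rpow_mul]; congr 1; ring
  rw [hea]
  set e := energy v ^ (1 / 2 : ℝ)
  rcases eq_or_ne P 0 with hP0 | hP0
  · have : N.toReal ≤ 0 := by
      refine nonpos_of_scales (D := 7 * K ^ 2) (e := e.toReal) (s := s) (g := g) (by linarith)
        fun m => ?_
      simpa [hP0] using hscale m
    have : N = 0 := by
      rcases (ENNReal.toReal_eq_zero_iff N).1 (le_antisymm this ENNReal.toReal_nonneg) with h | h
      · exact h
      · exact absurd h hN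
    rw [this]
    exact zero_le
  · have hPpos : 0 < P.toReal := ENNReal.toReal_pos hP0 hP
    have hPe : P.toReal ≤ e.toReal := ENNReal.toReal_mono he hPE
    have hepos : 0 < e.toReal := hPpos.trans_le hPe
    have h := interpolation_of_scales (D := 7 * K ^ 2) (by positivity) hPpos hPe hs hs1 hst hg hg1
      hscale
    rw [← ENNReal.ofReal_toReal hN, ← ENNReal.ofReal_toReal he, ← ENNReal.ofReal_toReal hP,
      ENNReal.ofReal_rpow_of_pos hepos, ENNReal.ofReal_rpow_of_pos hPpos,
      ← ENNReal.ofReal_mul (by positivity), ← ENNReal.ofReal_coe_nnreal,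
      ← ENNReal.ofReal_mul (by positivity)]
    refine ENNReal.ofReal_le_ofReal (h.trans (le_of_eq ?_))
    push_cast
    ring

theorem sobolevIneq_of_regular (hK : 1 ≤ K) (hα : 0 ≤ α) (hα1 : α ≤ 1)
    (hU : ∀ w : List (Fin 3), μ₁ (cell w) ≤ K * nu (cell w) ^ α)
    (hL : ∀ w : List (Fin 3), (K : ℝ≥0∞)⁻¹ * nu (cell w) ^ β ≤ μ₂ (cell w))
    (hp : 1 ≤ p) (hpq : p ≤ q) (hq2 : 2 ≤ q) (hst : α / q.toReal ≤ β / p.toReal) :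
    SobolevIneq μ₁ μ₂ q p
      ((β / p.toReal - α / q.toReal) / (β / p.toReal + 1 / (2 * deltaS))) (70 * K ^ 2) := by
  intro u hu c hc hc'
  have hv : Continuous fun x => u x - c := by fun_prop
  have hE : energy u ≠ ∞ := ne_of_lt hu
  rcases le_total (eLpNorm (fun x => u x - c) p μ₂) (energy u ^ (1 / 2 : ℝ)) with h | h
  · have h1 := eLpNorm_le_of_le_energy hK hα hα1 hU hL hp hpq hq2 hst hv
      (by rwa [energy_sub_const]) (by rwa [energy_sub_const])
    rwa [energy_sub_const, ← mul_assoc] at h1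
  -- Here `e ≤ P`. The bound `7e` on `|u - c|` suffices, since `e = e^a e^{1-a} ≤ e^a P^{1-a}` for
  -- `0 ≤ a ≤ 1`.
  · have hg := two_deltaS_inv_pos
    have hs : 0 ≤ α / q.toReal := by positivity
    set s := α / q.toReal
    set t := β / p.toReal
    set g := 1 / (2 * deltaS)
    set a := (t - s) / (t + g)
    have ha0 : 0 ≤ a := div_nonneg (by linarith) (by linarith)
    have ha1 : a ≤ 1 := div_le_one_of_le₀ (by linarith) (by linarith)
    have huniv : μ₁ Set.univ ≤ K := by
      have h1 := hU []
      rw [nu_cell] at h1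
      simpa [cell, cellMap] using h1
    have hbound := eLpNorm_le_of_enorm_le hK huniv (enorm_sub_const_le u.continuous hc hc')
      (hp.trans hpq)
    refine hbound.trans ?_
    have hea : energy u ^ (a / 2) = (energy u ^ (1 / 2 : ℝ)) ^ a := by
      rw [← ENNReal.rpow_mul]; congr 1; ring
    set e := energy u ^ (1 / 2 : ℝ)
    set P := eLpNorm (fun x => u x - c) p μ₂
    have hKr : 7 * K ≤ 70 * K ^ 2 := by
      have : K ≤ K ^ 2 := le_self_pow₀ hK (by norm_num)
      calc 7 * K ≤ 70 * K := by gcongr; norm_num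
        _ ≤ 70 * K ^ 2 := by gcongr
    calc (K : ℝ≥0∞) * (7 * e) = (7 * K : ℝ≥0) * e := by push_cast; ring
      _ ≤ (70 * K ^ 2 : ℝ≥0) * (e ^ a * e ^ (1 - a)) := by
          rw [← ENNReal.rpow_add_of_nonneg _ _ ha0 (by linarith), add_sub_cancel, ENNReal.rpow_one]
          gcongr
      _ ≤ (70 * K ^ 2 : ℝ≥0) * (e ^ a * P ^ (1 - a)) := by
          gcongr
      _ = _ := by rw [hea, mul_assoc]

theorem inhomSobolevIneq_of_regular (hK : 1 ≤ K) (hα : 0 ≤ α) (hα1 : α ≤ 1)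
    (hU : ∀ w : List (Fin 3), μ₁ (cell w) ≤ K * nu (cell w) ^ α)
    (hL : ∀ w : List (Fin 3), (K : ℝ≥0∞)⁻¹ * nu (cell w) ^ β ≤ μ₂ (cell w))
    (hp : 1 ≤ p) (hpq : p ≤ q) (hq2 : 2 ≤ q) (hst : α / q.toReal ≤ β / p.toReal) :
    InhomSobolevIneq μ₁ μ₂ q p
      ((β / p.toReal - α / q.toReal) / (β / p.toReal + 1 / (2 * deltaS))) (70 * K ^ 2) := by
  intro u hu
  have hE : energy u ≠ ∞ := ne_of_lt hu
  rcases le_total (eLpNorm u p μ₂) (energy u ^ (1 / 2 : ℝ)) with h | h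
  · refine (eLpNorm_le_of_le_energy hK hα hα1 hU hL hp hpq hq2 hst u.continuous hE h).trans ?_
    gcongr
    exact le_self_add
  · have hN : eLpNorm u q μ₁ ≠ ∞ := (memLp_of_continuous u.continuous q μ₁).eLpNorm_ne_top
    have hP : eLpNorm u p μ₂ ≠ ∞ := (memLp_of_continuous u.continuous p μ₂).eLpNorm_ne_top
    -- At scale `0` both powers of `3` are `1`, and `e ≤ P` leaves a multiple of `P`.
    have h0 := toReal_eLpNorm_le_scale hK hU hL u.continuous hE hp hpq hq2 0
    have h1 := ENNReal.toReal_mono hP h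
    simp only [Nat.cast_zero, zero_mul, neg_zero, Real.rpow_zero, one_mul] at h0
    have h2 : (eLpNorm u q μ₁).toReal ≤ ((70 * K ^ 2 : ℝ≥0) * eLpNorm u p μ₂).toReal := by
      rw [ENNReal.toReal_mul, ENNReal.coe_toReal]
      push_cast
      have h3 : 0 ≤ (K : ℝ) ^ 2 * (eLpNorm u p μ₂).toReal := by positivity
      have h4 : (K : ℝ) ^ 2 * (energy u ^ (1 / 2 : ℝ)).toReal ≤
        (K : ℝ) ^ 2 * (eLpNorm u p μ₂).toReal := by gcongr
      nlinarith
    refine ((ENNReal.toReal_le_toReal hN (by finiteness)).1 h2).trans ?_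
    gcongr
    exact le_add_self

end

/-- The bounds on `p` and `δ` exclude `0 * ∞`. For `p = ∞` the right side is a division by `∞.toReal
= 0`, which gives `0` in accordance with `1/∞ = 0`. -/
theorem one_div_mul_toReal {p δ : ℝ≥0∞} (hp : 1 ≤ p) (hδ : 0 < δ) :
    (1 / (p * δ)).toReal = (1 / δ).toReal / p.toReal := by
  rw [one_div, one_div, ENNReal.mul_inv (Or.inl (zero_lt_one.trans_le hp).ne') (Or.inr hδ.ne'),
    ENNReal.toReal_mul, ENNReal.toReal_inv p, mul_comm, div_eq_mul_inv]

theorem expUpper_eq {p q δ : ℝ≥0∞} (hq : 1 ≤ q) (hδ : 0 < δ) :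
    expUpper p q δ = max ((1 / p.toReal - (1 / δ).toReal / q.toReal) /
      (1 / p.toReal + 1 / (2 * deltaS))) 0 := by
  rw [expUpper, one_div_mul_toReal hq hδ, ENNReal.toReal_div, ENNReal.toReal_one]

theorem expLower_eq {p q δ : ℝ≥0∞} (hp : 1 ≤ p) (hδ : 0 < δ) :
    expLower p q δ = max (((1 / δ).toReal / p.toReal - 1 / q.toReal) /
      ((1 / δ).toReal / p.toReal + 1 / (2 * deltaS))) 0 := by
  rw [expLower, one_div_mul_toReal hp hδ, ENNReal.toReal_div 1 q, ENNReal.toReal_one]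

theorem one_div_toReal_le {p q : ℝ≥0∞} (hp : 1 ≤ p) (hpq : p ≤ q) :
    1 / q.toReal ≤ 1 / p.toReal := by
  by_cases hq : q = ∞
  · simp [hq]
  · have hpt : p ≠ ∞ := ne_top_of_le_ne_top hq hpq
    exact one_div_le_one_div_of_le (ENNReal.toReal_pos (zero_lt_one.trans_le hp).ne' hpt)
      (ENNReal.toReal_mono hq hpq)

theorem sobolev_upper (K : ℝ≥0) {p q δ : ℝ≥0∞} (hp : 1 ≤ p) (hpq : p ≤ q) (hq2 : 2 ≤ q)
    (hδ : 1 ≤ δ) (σ : Measure Gasket) [IsFiniteMeasure σ] (hσ : UpperRegular σ δ K) :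
    SobolevIneq σ nu q p (expUpper p q δ) (70 * max K 1 ^ 2) ∧
      InhomSobolevIneq σ nu q p (expUpper p q δ) (70 * max K 1 ^ 2) := by
  have hα : 0 ≤ (1 / δ).toReal := ENNReal.toReal_nonneg
  have hα1 : (1 / δ).toReal ≤ 1 := by
    rw [← ENNReal.toReal_one]
    refine ENNReal.toReal_mono ENNReal.one_ne_top ?_
    rwa [one_div, ENNReal.inv_le_one]
  have hK : 1 ≤ max K 1 := le_max_right _ _
  have hU : ∀ w : List (Fin 3), σ (cell w) ≤ (max K 1 : ℝ≥0) * nu (cell w) ^ (1 / δ).toReal :=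
    fun w => (hσ w).trans (by gcongr; exact le_max_left _ _)
  have hL : ∀ w : List (Fin 3), ((max K 1 : ℝ≥0) : ℝ≥0∞)⁻¹ * nu (cell w) ^ (1 : ℝ) ≤
      nu (cell w) := by
    intro w
    rw [ENNReal.rpow_one]
    refine mul_le_of_le_one_left zero_le ?_
    rw [ENNReal.inv_le_one]
    exact_mod_cast hK
  have hst : (1 / δ).toReal / q.toReal ≤ 1 / p.toReal := by
    refine le_trans ?_ (one_div_toReal_le hp hpq)
    gcongr
  have ha : expUpper p q δ = (1 / p.toReal - (1 / δ).toReal / q.toReal) /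
      (1 / p.toReal + 1 / (2 * deltaS)) := by
    rw [expUpper_eq (hp.trans hpq) (zero_lt_one.trans_le hδ)]
    have := two_deltaS_inv_pos
    exact max_eq_left (div_nonneg (by linarith) (by positivity))
  rw [ha]
  exact ⟨sobolevIneq_of_regular hK hα hα1 hU hL hp hpq hq2 hst,
    inhomSobolevIneq_of_regular hK hα hα1 hU hL hp hpq hq2 hst⟩

/-- A finite measure cannot be lower regular with an exponent less than `1`. -/
theorem one_le_of_lowerRegular {β : ℝ} {K : ℝ≥0} (hK : 1 ≤ K) {σ : Measure Gasket}
    [IsFiniteMeasure σ]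
    (hL : ∀ w : List (Fin 3), (K : ℝ≥0∞)⁻¹ * nu (cell w) ^ β ≤ σ (cell w)) : 1 ≤ β := by
  by_contra! hlt
  have hKr : (1 : ℝ) ≤ K := by exact_mod_cast hK
  have hbound : ∀ m : ℕ, ((3 : ℝ) ^ (1 - β)) ^ m ≤ 3 * (σ Set.univ).toReal * K := by
    intro m
    -- There are `3^m` cells, each of `σ`-mass at least `K⁻¹ 3^{-mβ}`, and they overlap at most
    -- threefold; for `β < 1` this total is unbounded in `m`.
    have h1 : ∑ _w : Fin m → Fin 3, (K : ℝ≥0∞)⁻¹ * ENNReal.ofReal (3 ^ (-(m * β))) ≤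
        3 * σ Set.univ := by
      refine le_trans (Finset.sum_le_sum fun w _ => ?_)
        (by simpa using sum_words_lintegral_cell_le σ m (f := fun _ => 1) measurable_const)
      have h2 := hL (List.ofFn w)
      rwa [nu_cell, List.length_ofFn, inv_pow_rpow] at h2
    have h3 := ENNReal.toReal_mono (by finiteness) h1
    simp only [Finset.sum_const, Finset.card_univ, Fintype.card_pi, Fintype.card_fin,
      Finset.prod_const, nsmul_eq_mul, Nat.cast_pow, Nat.cast_ofNat, ENNReal.toReal_mul,
      ENNReal.toReal_pow, ENNReal.toReal_ofNat, ENNReal.toReal_inv, ENNReal.coe_toReal] at h3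
    rw [ENNReal.toReal_ofReal (by positivity)] at h3
    have h4 : ((3 : ℝ) ^ (1 - β)) ^ m = 3 ^ m * 3 ^ (-(m * β)) := by
      rw [← Real.rpow_mul_natCast (by norm_num), ← Real.rpow_natCast 3 m,
        ← Real.rpow_add (by norm_num)]
      congr 1
      ring
    rw [h4]
    calc (3 : ℝ) ^ m * 3 ^ (-(m * β)) = 3 ^ m * ((K : ℝ)⁻¹ * 3 ^ (-(m * β))) * K := by
          field_simp
      _ ≤ _ := by gcongr
  have h3 : 1 < (3 : ℝ) ^ (1 - β) := Real.one_lt_rpow (by norm_num) (by linarith)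
  obtain ⟨m, hm⟩ := pow_unbounded_of_one_lt (3 * (σ Set.univ).toReal * K) h3
  exact absurd (hbound m) (not_le.2 hm)

theorem sobolev_lower (K : ℝ≥0) {p q δ : ℝ≥0∞} (hp : 1 ≤ p) (hpq : p ≤ q)
    (hq2 : 2 ≤ q) (hδ : 0 < δ) (σ : Measure Gasket) [IsFiniteMeasure σ]
    (hσ : LowerRegular σ δ K) :
    SobolevIneq nu σ q p (expLower p q δ) (70 * max K 1 ^ 2) ∧
      InhomSobolevIneq nu σ q p (expLower p q δ) (70 * max K 1 ^ 2) := by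
  have hK : 1 ≤ max K 1 := le_max_right _ _
  have hL : ∀ w : List (Fin 3),
      ((max K 1 : ℝ≥0) : ℝ≥0∞)⁻¹ * nu (cell w) ^ (1 / δ).toReal ≤ σ (cell w) :=
    fun w => le_trans (by gcongr; exact le_max_left _ _) (hσ w)
  have hβ : 1 ≤ (1 / δ).toReal := one_le_of_lowerRegular hK hL
  have hU : ∀ w : List (Fin 3), nu (cell w) ≤ (max K 1 : ℝ≥0) * nu (cell w) ^ (1 : ℝ) := by
    intro w
    rw [ENNReal.rpow_one]
    refine le_mul_of_one_le_left zero_le ?_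
    exact_mod_cast hK
  have hst : 1 / q.toReal ≤ (1 / δ).toReal / p.toReal := by
    refine (one_div_toReal_le hp hpq).trans ?_
    gcongr
  have ha : expLower p q δ = ((1 / δ).toReal / p.toReal - 1 / q.toReal) /
      ((1 / δ).toReal / p.toReal + 1 / (2 * deltaS)) := by
    rw [expLower_eq hp hδ]
    have := two_deltaS_inv_pos
    exact max_eq_left (div_nonneg (by linarith) (by positivity))
  rw [ha]
  exact ⟨sobolevIneq_of_regular hK zero_le_one le_rfl hU hL hp hpq hq2 hst,
    inhomSobolevIneq_of_regular hK zero_le_one le_rfl hU hL hp hpq hq2 hst⟩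

end SierpinskiGasket

namespace SierpinskiGasket

/-! ### Piecewise harmonic functions -/

/-- The index of a level-one cell that contains `x`. -/
noncomputable def letter (x : Gasket) : Fin 3 := (exists_F_eq x).choose

/-- The preimage of `x` in its level-one cell. -/
noncomputable def shift (x : Gasket) : Gasket := (exists_F_eq x).choose_spec.choose

theorem F_letter_shift (x : Gasket) : F (letter x) (shift x) = x :=
  (exists_F_eq x).choose_spec.choose_spec

/-- The function which is given by `g i` on the cell `F i (𝕊)`. -/
noncomputable def paste (g : Fin 3 → Gasket → ℝ) (x : Gasket) : ℝ := g (letter x) (shift x)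

/-- The arbitrary choice in `letter` and `shift` does not matter: it is ambiguous only at `F i
(vertex j) = F j (vertex i)`, where the pieces agree by `hg`. -/
theorem paste_F {g : Fin 3 → Gasket → ℝ} (hg : ∀ i j, g i (vertex j) = g j (vertex i))
    (i : Fin 3) (y : Gasket) : paste g (F i y) = g i y := by
  have h := F_letter_shift (F i y)
  unfold paste
  by_cases hi : letter (F i y) = i
  · rw [hi] at h ⊢
    rw [F_injective i h]
  · rw [eq_vertex_of_F_eq hi h, hg, ← eq_vertex_of_F_eq (Ne.symm hi) h.symm]

theorem continuous_paste {g : Fin 3 → Gasket → ℝ} (hc : ∀ i, Continuous (g i))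
    (hg : ∀ i j, g i (vertex j) = g j (vertex i)) : Continuous (paste g) := by
  refine continuous_iff_isClosed.2 fun s hs => ?_
  have h : paste g ⁻¹' s = ⋃ i, F i '' (g i ⁻¹' s) := by
    ext x
    obtain ⟨i, y, rfl⟩ := exists_F_eq x
    simp only [Set.mem_preimage, Set.mem_iUnion, Set.mem_image]
    constructor
    · intro hx
      exact ⟨i, y, by rwa [paste_F hg] at hx, rfl⟩
    · rintro ⟨j, z, hz, hzx⟩
      rwa [← hzx, paste_F hg]
  rw [h]
  exact isClosed_iUnion_of_finite fun i =>
    ((hs.preimage (hc i)).isCompact.image (continuous_F i)).isClosed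

/-- The values at the vertices of the cell `F i (𝕊)` of the harmonic function with the values `b`
at the corners. -/
noncomputable def harmonicStep (i : Fin 3) (b : Fin 3 → ℝ) (j : Fin 3) : ℝ :=
  if j = i then b i else (b i + b j + ∑ k, b k) / 5

theorem harmonicStep_comm (i j : Fin 3) (b : Fin 3 → ℝ) :
    harmonicStep i b j = harmonicStep j b i := by
  unfold harmonicStep
  by_cases h : j = i
  · simp [h]
  · simp [h, Ne.symm h, add_comm]

theorem harmonicStep_mem_Icc {lo hi : ℝ} {b : Fin 3 → ℝ} (hb : ∀ j, b j ∈ Set.Icc lo hi)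
    (i j : Fin 3) : harmonicStep i b j ∈ Set.Icc lo hi := by
  obtain ⟨h0, h0'⟩ := hb 0
  obtain ⟨h1, h1'⟩ := hb 1
  obtain ⟨h2, h2'⟩ := hb 2
  obtain ⟨hi, hi'⟩ := hb i
  obtain ⟨hj, hj'⟩ := hb j
  unfold harmonicStep
  split_ifs
  · exact hb i
  · rw [Fin.sum_univ_three]
    constructor <;> linarith

theorem abs_harmonicStep_sub_le {r : ℝ} {b : Fin 3 → ℝ} (hb : ∀ j k, |b j - b k| ≤ r)
    (i j k : Fin 3) : |harmonicStep i b j - harmonicStep i b k| ≤ 3 / 5 * r := by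
  have h01 := abs_le.1 (hb 0 1)
  have h02 := abs_le.1 (hb 0 2)
  have h12 := abs_le.1 (hb 1 2)
  rw [abs_le]
  fin_cases i <;> fin_cases j <;> fin_cases k <;> simp [harmonicStep, Fin.sum_univ_three] <;>
    first | linarith | (constructor <;> linarith)

/-- The approximations of the harmonic function with given corner values which interpolate
linearly on each cell of level `m`. -/
noncomputable def harmonicApprox : ℕ → (Fin 3 → ℝ) → Gasket → ℝ
  | 0, b => fun x => ∑ j, b j * bary j x
  | m + 1, b => paste fun i => harmonicApprox m (harmonicStep i b)

theorem harmonicApprox_vertex (m : ℕ) (b : Fin 3 → ℝ) (j : Fin 3) :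
    harmonicApprox m b (vertex j) = b j := by
  induction m generalizing b j with
  | zero => simp [harmonicApprox, bary_vertex]
  | succ m ih =>
    have hg : ∀ i j, harmonicApprox m (harmonicStep i b) (vertex j) =
        harmonicApprox m (harmonicStep j b) (vertex i) := fun i j => by
      rw [ih, ih, harmonicStep_comm]
    rw [harmonicApprox, ← F_vertex_self j, paste_F hg, ih]
    simp [harmonicStep]

theorem harmonicApprox_compat (m : ℕ) (b : Fin 3 → ℝ) (i j : Fin 3) :
    harmonicApprox m (harmonicStep i b) (vertex j) =
      harmonicApprox m (harmonicStep j b) (vertex i) := by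
  rw [harmonicApprox_vertex, harmonicApprox_vertex, harmonicStep_comm]

theorem harmonicApprox_succ_F (m : ℕ) (b : Fin 3 → ℝ) (i : Fin 3) (y : Gasket) :
    harmonicApprox (m + 1) b (F i y) = harmonicApprox m (harmonicStep i b) y :=
  paste_F (harmonicApprox_compat m b) i y

theorem continuous_harmonicApprox (m : ℕ) (b : Fin 3 → ℝ) : Continuous (harmonicApprox m b) := by
  induction m generalizing b with
  | zero =>
    exact continuous_finsetSum _ fun j _ =>
      continuous_const.mul ((continuous_bary j).comp continuous_subtype_val)
  | succ m ih => exact continuous_paste (fun i => ih _) (harmonicApprox_compat m b)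

theorem harmonicApprox_mem_Icc {lo hi : ℝ} (m : ℕ) {b : Fin 3 → ℝ}
    (hb : ∀ j, b j ∈ Set.Icc lo hi) (x : Gasket) : harmonicApprox m b x ∈ Set.Icc lo hi := by
  induction m generalizing b x with
  | zero =>
    have hs := sum_bary x
    have h : ∀ j, lo * bary j x ≤ b j * bary j x ∧ b j * bary j x ≤ hi * bary j x := fun j =>
      ⟨mul_le_mul_of_nonneg_right (hb j).1 (bary_nonneg j x.2),
        mul_le_mul_of_nonneg_right (hb j).2 (bary_nonneg j x.2)⟩
    have h0 := h 0
    have h1 := h 1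
    have h2 := h 2
    have hlo : lo * (bary 0 x + bary 1 x + bary 2 x) = lo := by rw [hs, mul_one]
    have hhi : hi * (bary 0 x + bary 1 x + bary 2 x) = hi := by rw [hs, mul_one]
    simp only [harmonicApprox, Fin.sum_univ_three]
    constructor <;> linarith
  | succ m ih =>
    obtain ⟨i, y, rfl⟩ := exists_F_eq x
    rw [harmonicApprox_succ_F]
    exact ih (harmonicStep_mem_Icc hb i) y

/-- At level `0` both functions lie between the extreme corner values; each further level shrinks
the spread of the corner values by `3/5`. Hence the approximations converge uniformly. -/
theorem abs_harmonicApprox_sub_le {r : ℝ} (m : ℕ) {b : Fin 3 → ℝ}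
    (hb : ∀ j k, |b j - b k| ≤ r) (x : Gasket) :
    |harmonicApprox m b x - harmonicApprox (m + 1) b x| ≤ r * (3 / 5) ^ m := by
  induction m generalizing b r x with
  | zero =>
    obtain ⟨lo, -, hlo⟩ := Finset.exists_min_image Finset.univ b Finset.univ_nonempty
    obtain ⟨hi, -, hhi⟩ := Finset.exists_max_image Finset.univ b Finset.univ_nonempty
    have hmem : ∀ j, b j ∈ Set.Icc (b lo) (b hi) := fun j =>
      ⟨hlo j (Finset.mem_univ j), hhi j (Finset.mem_univ j)⟩
    obtain ⟨h1, h1'⟩ := harmonicApprox_mem_Icc 0 hmem x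
    obtain ⟨h2, h2'⟩ := harmonicApprox_mem_Icc 1 hmem x
    have h3 := le_of_abs_le (hb hi lo)
    rw [pow_zero, mul_one, abs_le]
    constructor <;> linarith
  | succ m ih =>
    obtain ⟨i, y, rfl⟩ := exists_F_eq x
    rw [harmonicApprox_succ_F, harmonicApprox_succ_F]
    refine (ih (abs_harmonicStep_sub_le hb i) y).trans (le_of_eq ?_)
    ring

theorem exists_tendsto_harmonicApprox (b : Fin 3 → ℝ) :
    ∃ h : C(Gasket, ℝ), ∀ x, Tendsto (fun m => harmonicApprox m b x) atTop (𝓝 (h x)) := by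
  obtain ⟨r, hr⟩ : ∃ r, ∀ j k, |b j - b k| ≤ r := by
    refine ⟨∑ j, ∑ k, |b j - b k|, fun j k => ?_⟩
    refine le_trans ?_ (Finset.single_le_sum (f := fun j => ∑ k, |b j - b k|)
      (fun _ _ => by positivity) (Finset.mem_univ j))
    exact Finset.single_le_sum (f := fun k => |b j - b k|)
      (fun _ _ => by positivity) (Finset.mem_univ k)
  have hr0 : 0 ≤ r := (abs_nonneg _).trans (hr 0 0)
  have hc : CauchySeq fun m => (⟨harmonicApprox m b, continuous_harmonicApprox m b⟩ :
      C(Gasket, ℝ)) := by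
    refine cauchySeq_of_le_geometric (3 / 5) r (by norm_num) fun m => ?_
    rw [ContinuousMap.dist_le (by positivity)]
    exact fun x => abs_harmonicApprox_sub_le m hr x
  obtain ⟨h, hh⟩ := cauchySeq_tendsto_of_complete hc
  exact ⟨h, fun x => (continuous_eval_const x).continuousAt.tendsto.comp hh⟩

/-- The harmonic function with given corner values. -/
noncomputable def harmonic (b : Fin 3 → ℝ) : C(Gasket, ℝ) := (exists_tendsto_harmonicApprox b).choose

theorem tendsto_harmonicApprox (b : Fin 3 → ℝ) (x : Gasket) :
    Tendsto (fun m => harmonicApprox m b x) atTop (𝓝 (harmonic b x)) :=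
  (exists_tendsto_harmonicApprox b).choose_spec x

theorem harmonic_F (b : Fin 3 → ℝ) (i : Fin 3) (y : Gasket) :
    harmonic b (F i y) = harmonic (harmonicStep i b) y := by
  refine tendsto_nhds_unique ((tendsto_add_atTop_iff_nat 1).2 (tendsto_harmonicApprox b (F i y))) ?_
  simp_rw [harmonicApprox_succ_F]
  exact tendsto_harmonicApprox _ y

theorem harmonic_vertex (b : Fin 3 → ℝ) (j : Fin 3) : harmonic b (vertex j) = b j := by
  refine tendsto_nhds_unique (tendsto_harmonicApprox b (vertex j)) ?_
  simp_rw [harmonicApprox_vertex]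
  exact tendsto_const_nhds

theorem harmonic_mem_Icc {lo hi : ℝ} {b : Fin 3 → ℝ} (hb : ∀ j, b j ∈ Set.Icc lo hi)
    (x : Gasket) : harmonic b x ∈ Set.Icc lo hi :=
  isClosed_Icc.mem_of_tendsto (tendsto_harmonicApprox b x)
    (Eventually.of_forall fun m => harmonicApprox_mem_Icc m hb x)

theorem levelEnergy_zero (u : Gasket → ℝ) :
    levelEnergy 0 u = ∑ i, ∑ j, (1 / 2 : ℝ) * (u (vertex i) - u (vertex j)) ^ 2 := by
  simp [levelEnergy, cellMap]

/-- The rule with weights `2/5, 2/5, 1/5` in `harmonicStep` makes the energies of the three subcells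
add up to `3/5` of the original, which the factor `5/3` cancels. -/
theorem levelEnergy_harmonic (m : ℕ) (b : Fin 3 → ℝ) :
    levelEnergy m (harmonic b) = ∑ i, ∑ j, (1 / 2 : ℝ) * (b i - b j) ^ 2 := by
  induction m generalizing b with
  | zero => simp_rw [levelEnergy_zero, harmonic_vertex]
  | succ m ih =>
    rw [levelEnergy_succ]
    have h : ∀ k, (harmonic b : Gasket → ℝ) ∘ F k = harmonic (harmonicStep k b) := fun k =>
      funext fun y => harmonic_F b k y
    simp_rw [h, ih]
    simp [harmonicStep, Fin.sum_univ_three]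
    ring

theorem energy_harmonic (b : Fin 3 → ℝ) :
    energy (harmonic b) = ENNReal.ofReal (∑ i, ∑ j, (1 / 2 : ℝ) * (b i - b j) ^ 2) := by
  simp_rw [energy, levelEnergy_harmonic, ciSup_const]

/-- The function which agrees with `g` at the vertices of level `m` and is harmonic on the cells
of level `m`. -/
noncomputable def harmonicExtension : ℕ → (Gasket → ℝ) → Gasket → ℝ
  | 0, g => harmonic fun j => g (vertex j)
  | m + 1, g => paste fun i => harmonicExtension m (g ∘ F i)

theorem harmonicExtension_vertex (m : ℕ) (g : Gasket → ℝ) (j : Fin 3) :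
    harmonicExtension m g (vertex j) = g (vertex j) := by
  induction m generalizing g j with
  | zero => rw [harmonicExtension, harmonic_vertex]
  | succ m ih =>
    have hg : ∀ i j, harmonicExtension m (g ∘ F i) (vertex j) =
        harmonicExtension m (g ∘ F j) (vertex i) := fun i j => by
      rw [ih, ih, Function.comp_apply, Function.comp_apply, F_vertex_comm]
    rw [harmonicExtension, ← F_vertex_self j, paste_F hg, ih, Function.comp_apply]

theorem harmonicExtension_compat (m : ℕ) (g : Gasket → ℝ) (i j : Fin 3) :
    harmonicExtension m (g ∘ F i) (vertex j) = harmonicExtension m (g ∘ F j) (vertex i) := by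
  rw [harmonicExtension_vertex, harmonicExtension_vertex, Function.comp_apply,
    Function.comp_apply, F_vertex_comm]

theorem harmonicExtension_succ_F (m : ℕ) (g : Gasket → ℝ) (i : Fin 3) (y : Gasket) :
    harmonicExtension (m + 1) g (F i y) = harmonicExtension m (g ∘ F i) y :=
  paste_F (harmonicExtension_compat m g) i y

theorem continuous_harmonicExtension (m : ℕ) (g : Gasket → ℝ) :
    Continuous (harmonicExtension m g) := by
  induction m generalizing g with
  | zero => exact (harmonic _).continuous
  | succ m ih => exact continuous_paste (fun i => ih _) (harmonicExtension_compat m g)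

theorem harmonicExtension_cellMap (w : List (Fin 3)) (g : Gasket → ℝ) (y : Gasket) :
    harmonicExtension w.length g (cellMap w y) =
      harmonic (fun j => g (cellMap w (vertex j))) y := by
  induction w generalizing g with
  | nil => rfl
  | cons i w ih =>
    rw [List.length_cons, cellMap, Function.comp_apply, harmonicExtension_succ_F, ih]
    rfl

theorem harmonicExtension_ofFn {m : ℕ} (w : Fin m → Fin 3) (g : Gasket → ℝ) (y : Gasket) :
    harmonicExtension m g (cellMap (List.ofFn w) y) =
      harmonic (fun j => g (cellMap (List.ofFn w) (vertex j))) y := by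
  have h := harmonicExtension_cellMap (List.ofFn w) g y
  rwa [List.length_ofFn] at h

theorem harmonicExtension_mem_Icc {lo hi : ℝ} (m : ℕ) {g : Gasket → ℝ}
    (hg : ∀ x, g x ∈ Set.Icc lo hi) (x : Gasket) : harmonicExtension m g x ∈ Set.Icc lo hi := by
  obtain ⟨w, y, rfl⟩ := exists_mem_cell m x
  rw [harmonicExtension_ofFn]
  exact harmonic_mem_Icc (fun j => hg _) y

/-- Energy is additive over cells, and on each cell the harmonic piece has no more energy than its
corner values show. -/
theorem energy_harmonicExtension (m : ℕ) (g : Gasket → ℝ) :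
    energy (harmonicExtension m g) = ENNReal.ofReal (levelEnergy m g) := by
  have h : ∀ w : Fin m → Fin 3, harmonicExtension m g ∘ cellMap (List.ofFn w) =
      harmonic fun j => g (cellMap (List.ofFn w) (vertex j)) := fun w =>
    funext fun y => harmonicExtension_ofFn w g y
  rw [energy_eq_sum_words m, levelEnergy, ENNReal.ofReal_sum_of_nonneg fun _ _ => by positivity]
  refine Finset.sum_congr rfl fun w _ => ?_
  rw [h, energy_harmonic, ← ENNReal.ofReal_pow (by norm_num), ← ENNReal.ofReal_mul (by positivity),
    Finset.mul_sum]
  congr 1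
  refine Finset.sum_congr rfl fun i _ => ?_
  rw [Finset.mul_sum]
  refine Finset.sum_congr rfl fun j _ => ?_
  ring

end SierpinskiGasket

namespace SierpinskiGasket

/-! ### Test functions and optimality of the exponents -/

/-- The piecewise harmonic function which is `1` at the points of `A` and `0` at the other
vertices of level `m`. -/
noncomputable def bump (m : ℕ) (A : Finset Gasket) : Gasket → ℝ :=
  harmonicExtension m ((A : Set Gasket).indicator 1)

theorem continuous_bump (m : ℕ) (A : Finset Gasket) : Continuous (bump m A) :=
  continuous_harmonicExtension m _

theorem indicator_one_mem_Icc (A : Set Gasket) (x : Gasket) :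
    A.indicator (1 : Gasket → ℝ) x ∈ Set.Icc 0 1 := by
  by_cases hx : x ∈ A <;> simp [hx]

theorem bump_mem_Icc (m : ℕ) (A : Finset Gasket) (x : Gasket) : bump m A x ∈ Set.Icc 0 1 :=
  harmonicExtension_mem_Icc m (indicator_one_mem_Icc A) x

theorem sum_sum_indicator_cell_le (m : ℕ) (A : Finset Gasket) :
    ∑ w : Fin m → Fin 3, ∑ x ∈ A, (cell (List.ofFn w)).indicator (1 : Gasket → ℝ≥0∞) x ≤
      3 * A.card := by
  rw [Finset.sum_comm]
  refine (Finset.sum_le_card_nsmul _ _ 3 fun x _ => sum_words_indicator_le m x).trans ?_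
  rw [nsmul_eq_mul, mul_comm]

theorem one_le_sum_indicator_cell {A : Finset Gasket} {w : List (Fin 3)} {x : Gasket} (hx : x ∈ A)
    (hxw : x ∈ cell w) : 1 ≤ ∑ x ∈ A, (cell w).indicator (1 : Gasket → ℝ≥0∞) x := by
  refine le_trans ?_ (Finset.single_le_sum (f := fun x => (cell w).indicator (1 : Gasket → ℝ≥0∞) x)
    (fun _ _ => zero_le) hx)
  simp [hxw]

/-- Only cells with a corner in `A` contribute, at most `3|A|` of them. Each gives at most `9/2 *
(5/3)^m` from nine ordered pairs, and `3 * 9/2 ≤ 14`. -/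
theorem energy_bump_le (m : ℕ) (A : Finset Gasket) :
    energy (bump m A) ≤ 14 * A.card * ENNReal.ofReal ((5 / 3) ^ m) := by
  rw [bump, energy_harmonicExtension, levelEnergy,
    ENNReal.ofReal_sum_of_nonneg fun _ _ => by positivity]
  set g : Gasket → ℝ := (A : Set Gasket).indicator 1
  calc _ ≤ ∑ w : Fin m → Fin 3, ENNReal.ofReal (9 / 2 * (5 / 3) ^ m) *
        ∑ x ∈ A, (cell (List.ofFn w)).indicator (1 : Gasket → ℝ≥0∞) x := by
        refine Finset.sum_le_sum fun w _ => ?_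
        by_cases h : ∃ j, cellMap (List.ofFn w) (vertex j) ∈ A
        · obtain ⟨j, hj⟩ := h
          refine le_trans (ENNReal.ofReal_le_ofReal ?_)
            (le_mul_of_one_le_right zero_le (one_le_sum_indicator_cell hj ⟨_, rfl⟩))
          have hle : ∀ x y, (g x - g y) ^ 2 ≤ 1 := by
            intro x y
            obtain ⟨h1, h2⟩ := indicator_one_mem_Icc A x
            obtain ⟨h3, h4⟩ := indicator_one_mem_Icc A y
            rw [sq_le_one_iff_abs_le_one, abs_le]
            constructor <;> linarith
          calc _ ≤ ∑ i : Fin 3, ∑ j : Fin 3, (1 / 2 : ℝ) * (5 / 3) ^ m * 1 := by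
                gcongr
                exact hle _ _
            _ = _ := by simp; ring
        · push Not at h
          have h0 : ∀ j, g (cellMap (List.ofFn w) (vertex j)) = 0 := fun j =>
            Set.indicator_of_notMem (by simpa using h j) _
          simp [h0]
    _ ≤ ENNReal.ofReal (9 / 2 * (5 / 3) ^ m) * (3 * A.card) := by
        rw [← Finset.mul_sum]
        gcongr
        exact sum_sum_indicator_cell_le m A
    _ = (ENNReal.ofReal (9 / 2) * 3) * A.card * ENNReal.ofReal ((5 / 3) ^ m) := by
        rw [ENNReal.ofReal_mul (by norm_num)]
        ring
    _ ≤ _ := by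
        gcongr
        rw [← ENNReal.ofReal_ofNat 3, ← ENNReal.ofReal_ofNat 14,
          ← ENNReal.ofReal_mul (by norm_num)]
        exact ENNReal.ofReal_le_ofReal (by norm_num)

theorem exists_of_bump_ne_zero {m : ℕ} {A : Finset Gasket} {z : Gasket} (hz : bump m A z ≠ 0) :
    ∃ (w : Fin m → Fin 3) (j : Fin 3), z ∈ cell (List.ofFn w) ∧
      cellMap (List.ofFn w) (vertex j) ∈ A := by
  obtain ⟨w, y, rfl⟩ := exists_mem_cell m z
  refine ⟨w, ?_⟩
  by_contra! h
  refine hz ?_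
  rw [bump, harmonicExtension_ofFn]
  have h0 : ∀ j, (A : Set Gasket).indicator (1 : Gasket → ℝ)
      (cellMap (List.ofFn w) (vertex j)) ∈ Set.Icc (0 : ℝ) 0 := fun j => by
    rw [Set.indicator_of_notMem (by simpa using h j ⟨y, rfl⟩)]
    simp
  exact le_antisymm (harmonic_mem_Icc h0 y).2 (harmonic_mem_Icc h0 y).1

theorem nu_bump_ne_zero_le (m : ℕ) (A : Finset Gasket) :
    nu {z | bump m A z ≠ 0} ≤ 3 * A.card * (3⁻¹) ^ m := by
  have hsub : {z | bump m A z ≠ 0} ⊆ ⋃ w : Fin m → Fin 3,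
      {z | z ∈ cell (List.ofFn w) ∧ ∃ x ∈ A, x ∈ cell (List.ofFn w)} := by
    intro z hz
    obtain ⟨w, j, h1, h2⟩ := exists_of_bump_ne_zero hz
    exact Set.mem_iUnion.2 ⟨w, h1, _, h2, ⟨_, rfl⟩⟩
  refine (measure_mono hsub).trans ((measure_iUnion_le _).trans ?_)
  rw [tsum_fintype]
  calc _ ≤ ∑ w : Fin m → Fin 3,
        (∑ x ∈ A, (cell (List.ofFn w)).indicator (1 : Gasket → ℝ≥0∞) x) * (3⁻¹) ^ m := by
        refine Finset.sum_le_sum fun w _ => ?_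
        by_cases h : ∃ x ∈ A, x ∈ cell (List.ofFn w)
        · obtain ⟨x, hx, hxw⟩ := h
          refine le_trans (measure_mono fun z hz => hz.1) ?_
          rw [nu_cell, List.length_ofFn]
          exact le_mul_of_one_le_left zero_le (one_le_sum_indicator_cell hx hxw)
        · simp [h]
    _ ≤ _ := by
        rw [← Finset.sum_mul]
        gcongr
        exact sum_sum_indicator_cell_le m A

theorem eLpNorm_le_measure_rpow (μ : Measure Gasket) {u : Gasket → ℝ} (p : ℝ≥0∞)
    {s : Set Gasket} (hu : ∀ x, u x ∈ Set.Icc 0 1) (hs : ∀ x, u x ≠ 0 → x ∈ s) :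
    eLpNorm u p μ ≤ μ s ^ (1 / p.toReal) := by
  refine (eLpNorm_mono_real (g := s.indicator fun _ => (1 : ℝ)) fun x => ?_).trans
    ((eLpNorm_indicator_const_le 1 p).trans (by simp))
  by_cases hx : x ∈ s
  · rw [Set.indicator_of_mem hx, Real.norm_eq_abs, abs_of_nonneg (hu x).1]
    exact (hu x).2
  · rw [Set.indicator_of_notMem hx, not_not.1 (mt (hs x) hx), norm_zero]

theorem mul_measure_rpow_le_eLpNorm {μ : Measure Gasket} {u : Gasket → ℝ} {p : ℝ≥0∞} (hp : 1 ≤ p)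
    {s : Set Gasket} (hs : MeasurableSet s) (hμ : μ s ≠ 0) {c : ℝ} (hc : 0 ≤ c)
    (hu : ∀ x ∈ s, c ≤ u x) : ENNReal.ofReal c * μ s ^ (1 / p.toReal) ≤ eLpNorm u p μ := by
  calc ENNReal.ofReal c * μ s ^ (1 / p.toReal)
      = eLpNorm (fun _ : Gasket => c) p (μ.restrict s) := by
        rw [eLpNorm_const _ (zero_lt_one.trans_le hp).ne' (by rwa [Ne, Measure.restrict_eq_zero]),
          Measure.restrict_apply_univ, Real.enorm_of_nonneg hc]
    _ ≤ eLpNorm u p (μ.restrict s) := by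
        refine eLpNorm_mono_ae ?_
        filter_upwards [ae_restrict_mem hs] with x hx
        rw [Real.norm_of_nonneg hc]
        exact (hu x hx).trans (le_abs_self _)
    _ ≤ eLpNorm u p μ := eLpNorm_mono_measure _ Measure.restrict_le_self

/-- The Sobolev inequality for a bump with constant `c = 0`. -/
theorem SobolevIneq.bump_le {σ₁ σ₂ : Measure Gasket} {q p : ℝ≥0∞} {b : ℝ} {C : ℝ≥0}
    (h : SobolevIneq σ₁ σ₂ q p b C) (m : ℕ) (A : Finset Gasket) {z : Gasket}
    (hz : bump m A z = 0) :
    eLpNorm (bump m A) q σ₁ ≤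
      C * energy (bump m A) ^ (b / 2) * eLpNorm (bump m A) p σ₂ ^ (1 - b) := by
  have hmem := bump_mem_Icc m A
  have hE : energy (bump m A) < ∞ := (energy_bump_le m A).trans_lt (by finiteness)
  have h0 := h ⟨bump m A, continuous_bump m A⟩ hE 0
    ((ciInf_le ⟨0, by rintro _ ⟨x, rfl⟩; exact (hmem x).1⟩ z).trans_eq hz)
    (hz.symm.le.trans (le_ciSup ⟨1, by rintro _ ⟨x, rfl⟩; exact (hmem x).2⟩ z))
  simpa using h0

/-- The bump around a cell yields a lower bound for the `L^q`-norm by the measure of the cell. -/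
theorem SobolevIneq.measure_cell_le {σ : Measure Gasket} {q p : ℝ≥0∞} {b : ℝ} {C : ℝ≥0}
    (h : SobolevIneq σ nu q p b C) (hq : 1 ≤ q) (hb : 0 ≤ b) (hb1 : b ≤ 1) {w : List (Fin 3)}
    (hw : w ≠ []) (hσ : σ (cell w) ≠ 0) :
    σ (cell w) ^ (1 / q.toReal) ≤
      (C * 42 ^ (b / 2) * (9 ^ (1 / p.toReal)) ^ (1 - b)) *
        ENNReal.ofReal ((5 / 3) ^ w.length) ^ (b / 2) *
        (nu (cell w) ^ (1 / p.toReal)) ^ (1 - b) := by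
  classical
  set A : Finset Gasket := Finset.univ.image fun j => cellMap w (vertex j) with hA
  have hcard : (A.card : ℝ≥0∞) ≤ 3 := by
    have : A.card ≤ 3 := Finset.card_image_le.trans (by simp)
    exact_mod_cast this
  obtain ⟨i, w', rfl⟩ := List.exists_cons_of_ne_nil hw
  -- A nonempty word keeps the cell inside `F i (𝕊)`, which misses the other corners; this provides
  -- the zero that makes `c = 0` admissible.
  have hz : bump (i :: w').length A (vertex (i + 1)) = 0 := by
    rw [bump, harmonicExtension_vertex, Set.indicator_of_notMem]
    intro hmem
    simp only [hA, Finset.coe_image, Finset.coe_univ, Set.image_univ] at hmem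
    obtain ⟨j, hj⟩ := hmem
    have := (eq_vertex_of_cellMap_eq_vertex hj).2 i (by simp)
    simp at this
  have hle := h.bump_le _ A hz
  have hone : ∀ x ∈ cell (i :: w'), 1 ≤ bump (i :: w').length A x := by
    rintro _ ⟨y, rfl⟩
    rw [bump, harmonicExtension_cellMap]
    refine (harmonic_mem_Icc (lo := 1) (hi := 1) (fun j => ?_) y).1
    rw [Set.indicator_of_mem]
    · simp
    · simp [hA]
  set w := i :: w'
  have hlow := mul_measure_rpow_le_eLpNorm hq (measurableSet_cell w) hσ zero_le_one hone
  rw [ENNReal.ofReal_one, one_mul] at hlow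
  refine hlow.trans (hle.trans ?_)
  have hE : energy (bump w.length A) ≤ 42 * ENNReal.ofReal ((5 / 3) ^ w.length) := by
    refine (energy_bump_le _ A).trans ?_
    gcongr
    calc (14 : ℝ≥0∞) * A.card ≤ 14 * 3 := by gcongr
      _ = 42 := by norm_num
  have hP : eLpNorm (bump w.length A) p nu ≤ (9 * nu (cell w)) ^ (1 / p.toReal) := by
    refine (eLpNorm_le_measure_rpow nu p (bump_mem_Icc _ A) (s := {z | bump w.length A z ≠ 0})
      fun x hx => hx).trans ?_
    gcongr
    refine (nu_bump_ne_zero_le _ A).trans ?_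
    rw [nu_cell]
    gcongr
    calc (3 : ℝ≥0∞) * A.card ≤ 3 * 3 := by gcongr
      _ = 9 := by norm_num
  calc _ ≤ C * (42 * ENNReal.ofReal ((5 / 3) ^ w.length)) ^ (b / 2) *
        ((9 * nu (cell w)) ^ (1 / p.toReal)) ^ (1 - b) := by
        gcongr
    _ = _ := by
        rw [ENNReal.mul_rpow_of_nonneg _ _ (by linarith : 0 ≤ b / 2),
          ENNReal.mul_rpow_of_nonneg _ _ (by positivity : 0 ≤ 1 / p.toReal),
          ENNReal.mul_rpow_of_nonneg _ _ (by linarith : 0 ≤ 1 - b)]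
        ring

/-- A bump inside a cell yields an upper bound for the `L^p`-norm by the measure of the cell. -/
theorem SobolevIneq.nu_cell_le {σ : Measure Gasket} {q p : ℝ≥0∞} {b : ℝ} {C : ℝ≥0}
    (h : SobolevIneq nu σ q p b C) (hq : 1 ≤ q) (hb : 0 ≤ b) (hb1 : b ≤ 1) (w : List (Fin 3)) :
    (ENNReal.ofReal (2 / 5) * (9⁻¹) ^ (1 / q.toReal)) * nu (cell w) ^ (1 / q.toReal) ≤
      (C * (14 * ENNReal.ofReal (5 / 3)) ^ (b / 2)) *
        ENNReal.ofReal ((5 / 3) ^ w.length) ^ (b / 2) *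
        (σ (cell w) ^ (1 / p.toReal)) ^ (1 - b) := by
  -- A junction point of two subcells of `𝕊_w`. It is not a corner of `𝕊_w`, so a bump of level `|w|
  -- + 1` at `x₀` does not leave `𝕊_w`.
  set x₀ : Gasket := cellMap (w ++ [0]) (vertex 1) with hx₀
  have hlen : (w ++ [0]).length = w.length + 1 := by simp
  have hz : bump (w.length + 1) {x₀} (vertex 0) = 0 := by
    rw [bump, harmonicExtension_vertex, Set.indicator_of_notMem]
    intro hmem
    simp only [Finset.coe_singleton, Set.mem_singleton_iff] at hmem
    have := vertex_injective (eq_vertex_of_cellMap_eq_vertex (hx₀.symm.trans hmem.symm)).1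
    simp at this
  have hle := h.bump_le _ _ hz
  -- On `𝕊_{w0}` the corner values are `0, 1, 0`; one harmonic step gives `2/5, 1, 2/5` at the
  -- corners of `𝕊_{w01}`.
  have hbound : ∀ x ∈ cell (w ++ [0] ++ [1]), 2 / 5 ≤ bump (w.length + 1) {x₀} x := by
    rintro _ ⟨y, rfl⟩
    rw [cellMap_append (w ++ [0]), Function.comp_apply, bump, ← hlen, harmonicExtension_cellMap]
    have hval : ∀ j, (({x₀} : Finset Gasket) : Set Gasket).indicator (1 : Gasket → ℝ)
        (cellMap (w ++ [0]) (vertex j)) = if j = 1 then 1 else 0 := by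
      intro j
      split_ifs with hj
      · rw [hj, Set.indicator_of_mem (by simp [hx₀])]; rfl
      · rw [Set.indicator_of_notMem]
        simp only [Finset.coe_singleton, Set.mem_singleton_iff]
        exact fun he => hj (vertex_injective (cellMap_injective _ he))
    simp_rw [hval]
    simp only [cellMap, Function.comp_apply, id, harmonic_F]
    refine (harmonic_mem_Icc (lo := 2 / 5) (hi := 1) (fun j => ?_) y).1
    fin_cases j <;> simp [harmonicStep] <;> norm_num
  have hnu : nu (cell (w ++ [0] ++ [1])) = 9⁻¹ * nu (cell w) := by
    rw [nu_cell, nu_cell]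
    simp only [List.length_append, List.length_singleton, add_assoc, pow_add]
    rw [mul_comm]
    congr 1
    rw [pow_one, ← ENNReal.mul_inv (by simp) (by simp)]
    norm_num
  have hlow := mul_measure_rpow_le_eLpNorm hq (measurableSet_cell _)
    (by rw [nu_cell]; simp : nu (cell (w ++ [0] ++ [1])) ≠ 0) (by norm_num) hbound
  rw [hnu, ENNReal.mul_rpow_of_nonneg _ _ (by positivity), ← mul_assoc] at hlow
  refine hlow.trans (hle.trans ?_)
  have hE : energy (bump (w.length + 1) {x₀}) ≤
      14 * ENNReal.ofReal (5 / 3) * ENNReal.ofReal ((5 / 3) ^ w.length) := by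
    refine (energy_bump_le _ _).trans (le_of_eq ?_)
    rw [pow_succ', ENNReal.ofReal_mul (by norm_num)]
    simp [mul_assoc]
  have hP : eLpNorm (bump (w.length + 1) {x₀}) p σ ≤ σ (cell w) ^ (1 / p.toReal) := by
    refine eLpNorm_le_measure_rpow σ p (bump_mem_Icc _ _) fun z hzne => ?_
    obtain ⟨v, j, ⟨y, rfl⟩, hv⟩ := exists_of_bump_ne_zero hzne
    rw [Finset.mem_singleton, hx₀, List.ofFn_succ', List.concat_eq_append, cellMap_append,
      cellMap_append] at hv
    rw [List.ofFn_succ', List.concat_eq_append, cellMap_append]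
    simp only [cellMap, Function.comp_apply, id] at hv ⊢
    -- If the cell did not extend `w`, then `x₀` would be common to two distinct cells of level
    -- `|w|`, hence `F 0 (vertex 1)` would be a corner.
    by_cases hvw : (List.ofFn fun i : Fin w.length => v i.castSucc) = w
    · rw [hvw]
      exact ⟨_, rfl⟩
    · obtain ⟨k, hk⟩ := mem_range_vertex_of_cellMap_eq (by simp) (Ne.symm hvw) hv.symm
      obtain ⟨rfl, h2⟩ := eq_of_F_eq_vertex hk.symm
      simpa using vertex_injective h2
  calc _ ≤ C * (14 * ENNReal.ofReal (5 / 3) * ENNReal.ofReal ((5 / 3) ^ w.length)) ^ (b / 2) *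
        (σ (cell w) ^ (1 / p.toReal)) ^ (1 - b) := by
        gcongr
    _ = _ := by
        rw [ENNReal.mul_rpow_of_nonneg _ _ (by linarith : 0 ≤ b / 2)]
        ring

/-! ### Exponential rates along shrinking cells -/

theorem two_pow_inv_le_diam_cell (w : List (Fin 3)) :
    (1 / 2 : ℝ) ^ w.length ≤ Metric.diam (cell w) := by
  have h : ∀ x y : Gasket, dist (cellMap w x) (cellMap w y) = (1 / 2) ^ w.length * dist x y := by
    intro x y
    induction w with
    | nil => simp [cellMap]
    | cons i w ih =>
      have hF : ∀ x y : Gasket, dist (F i x) (F i y) = 1 / 2 * dist x y := by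
        intro x y
        simp only [Subtype.dist_eq, F, contr]
        rw [dist_smul₀, dist_add_right]
        norm_num
      rw [cellMap, Function.comp_apply, Function.comp_apply, hF, ih, List.length_cons, pow_succ']
      ring
  have h1 : dist (vertex 0) (vertex 1) = 1 := by
    simp [Subtype.dist_eq, vertex, corner, EuclideanSpace.dist_eq, Fin.sum_univ_two]
  have h2 := h (vertex 0) (vertex 1)
  rw [h1, mul_one] at h2
  rw [← h2]
  exact Metric.dist_le_diam_of_mem
    (isCompact_range (continuous_cellMap w)).isBounded ⟨_, rfl⟩ ⟨_, rfl⟩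

theorem tendsto_length_of_diam {w : ℕ → List (Fin 3)}
    (hw : Tendsto (fun n => Metric.diam (cell (w n))) atTop (𝓝 0)) :
    Tendsto (fun n => (w n).length) atTop atTop := by
  refine tendsto_atTop.2 fun N => ?_
  filter_upwards [hw.eventually_lt_const (by positivity : (0 : ℝ) < (1 / 2) ^ N)] with n hn
  by_contra! hlt
  have h1 : (1 / 2 : ℝ) ^ N ≤ (1 / 2) ^ (w n).length :=
    pow_le_pow_of_le_one (by norm_num) (by norm_num) hlt.le
  exact absurd ((two_pow_inv_le_diam_cell (w n)).trans_lt hn) (not_lt.2 h1)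

theorem log_nu_cell (w : List (Fin 3)) :
    Real.log (nu (cell w)).toReal = -(w.length * Real.log 3) := by
  rw [nu_cell]
  simp [Real.log_pow, Real.log_inv]

/-- Comparison of the exponential rates in an inequality along a sequence of shrinking cells. -/
theorem rate_le_of_inequality {w : ℕ → List (Fin 3)}
    (hw : Tendsto (fun n => (w n).length) atTop atTop) {Y Z : ℕ → ℝ≥0∞}
    (hY : ∀ n, Y n ≠ 0) (hY' : ∀ n, Y n ≠ ∞) (hZ : ∀ n, Z n ≠ 0) (hZ' : ∀ n, Z n ≠ ∞)
    {α β s t b : ℝ} (ht : 0 ≤ t) (hb : 0 ≤ b) (hb1 : b ≤ 1)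
    (hα : Tendsto (fun n => Real.log (Y n).toReal / Real.log (nu (cell (w n))).toReal) atTop (𝓝 α))
    (hβ : Tendsto (fun n => Real.log (Z n).toReal / Real.log (nu (cell (w n))).toReal) atTop (𝓝 β))
    {c D : ℝ≥0∞} (hc : c ≠ 0) (hc' : c ≠ ∞) (hD : D ≠ ∞)
    (h : ∀ᶠ n in atTop, c * Y n ^ s ≤
      D * ENNReal.ofReal ((5 / 3) ^ (w n).length) ^ (b / 2) * (Z n ^ t) ^ (1 - b)) :
    β * t - α * s ≤ b * (β * t + 1 / (2 * deltaS)) := by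
  have h3 : 0 < Real.log 3 := Real.log_pos (by norm_num)
  have hlen : Tendsto (fun n => ((w n).length : ℝ)) atTop atTop :=
    tendsto_natCast_atTop_atTop.comp hw
  -- The logarithm of the inequality divided by `|w_n| log 3 = -log ν(𝕊_{w_n})`. The constants
  -- disappear in the limit, and the energy factor contributes exactly `b/(2δ_s)`.
  have hev : ∀ᶠ n in atTop, (Real.log c.toReal - Real.log D.toReal) *
      (((w n).length : ℝ)⁻¹ * (Real.log 3)⁻¹) -
        s * (Real.log (Y n).toReal / Real.log (nu (cell (w n))).toReal) ≤
      b * (1 / (2 * deltaS)) -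
        t * (1 - b) * (Real.log (Z n).toReal / Real.log (nu (cell (w n))).toReal) := by
    filter_upwards [h, hlen.eventually_gt_atTop 0] with n hn hm
    have hYn : 0 < (Y n).toReal := ENNReal.toReal_pos (hY n) (hY' n)
    have hZn : 0 < (Z n).toReal := ENNReal.toReal_pos (hZ n) (hZ' n)
    have hcr : 0 < c.toReal := ENNReal.toReal_pos hc hc'
    have hZt : (Z n ^ t) ^ (1 - b) ≠ ∞ := ENNReal.rpow_ne_top_of_nonneg (by linarith)
      (ENNReal.rpow_ne_top_of_nonneg ht (hZ' n))
    have hEt : ENNReal.ofReal ((5 / 3) ^ (w n).length) ^ (b / 2) ≠ ∞ :=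
      ENNReal.rpow_ne_top_of_nonneg (by linarith) ENNReal.ofReal_ne_top
    have hr := ENNReal.toReal_mono (by finiteness) hn
    simp only [ENNReal.toReal_mul, ← ENNReal.toReal_rpow] at hr
    rw [ENNReal.toReal_ofReal (by positivity)] at hr
    have hDr : 0 < D.toReal := by
      rcases (ENNReal.toReal_nonneg (a := D)).eq_or_lt with h0 | h0
      · rw [← h0, zero_mul, zero_mul] at hr
        have : 0 < c.toReal * (Y n).toReal ^ s := by positivity
        linarith
      · exact h0
    have hlog := Real.log_le_log (by positivity) hr
    rw [Real.log_mul (by positivity) (by positivity), Real.log_mul (by positivity) (by positivity),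
      Real.log_mul (by positivity) (by positivity), Real.log_rpow hYn,
      Real.log_rpow (by positivity), Real.log_rpow (by positivity), Real.log_rpow hZn,
      Real.log_pow, Real.log_div (by norm_num) (by norm_num)] at hlog
    rw [log_nu_cell, two_deltaS_inv]
    have hpos : 0 < ((w n).length : ℝ) * Real.log 3 := by positivity
    rw [← sub_nonneg]
    have e : b * ((Real.log 5 / Real.log 3 - 1) / 2) -
        t * (1 - b) * (Real.log (Z n).toReal / -((w n).length * Real.log 3)) -
        ((Real.log c.toReal - Real.log D.toReal) * (((w n).length : ℝ)⁻¹ * (Real.log 3)⁻¹) -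
          s * (Real.log (Y n).toReal / -((w n).length * Real.log 3))) =
        (Real.log D.toReal + b / 2 * ((w n).length * (Real.log 5 - Real.log 3)) +
          (1 - b) * (t * Real.log (Z n).toReal) -
          (Real.log c.toReal + s * Real.log (Y n).toReal)) / ((w n).length * Real.log 3) := by
      field_simp
      ring
    rw [e]
    exact div_nonneg (by linarith) hpos.le
  have hinv : Tendsto (fun n => (Real.log c.toReal - Real.log D.toReal) *
      (((w n).length : ℝ)⁻¹ * (Real.log 3)⁻¹)) atTop (𝓝 0) := by
    have := ((tendsto_inv_atTop_zero.comp hlen).mul_const (Real.log 3)⁻¹).const_mul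
      (Real.log c.toReal - Real.log D.toReal)
    simpa using this
  have hlim := le_of_tendsto_of_tendsto (hinv.sub (hα.const_mul s))
    ((hβ.const_mul (t * (1 - b))).const_sub (b * (1 / (2 * deltaS)))) hev
  linarith

theorem tendsto_log_nu_div_self {w : ℕ → List (Fin 3)}
    (hw : Tendsto (fun n => (w n).length) atTop atTop) :
    Tendsto (fun n => Real.log (nu (cell (w n))).toReal / Real.log (nu (cell (w n))).toReal)
      atTop (𝓝 1) := by
  refine tendsto_const_nhds.congr' ?_
  filter_upwards [hw.eventually_gt_atTop 0] with n hn
  have h3 : 0 < Real.log 3 := Real.log_pos (by norm_num)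
  rw [div_self]
  rw [log_nu_cell]
  have : (0 : ℝ) < (w n).length := by exact_mod_cast hn
  exact neg_ne_zero.2 (by positivity)

theorem expUpper_le {p q δ : ℝ≥0∞} (hq : 1 ≤ q) (hδ : 0 < δ) {σ : Measure Gasket}
    [IsFiniteMeasure σ] (hσ : AttainsExponent σ δ) {b : ℝ} (hb : 0 ≤ b) (hb1 : b ≤ 1) {C : ℝ≥0}
    (h : SobolevIneq σ nu q p b C) : expUpper p q δ ≤ b := by
  obtain ⟨w, hdiam, hpos, hlim⟩ := hσ
  have hw := tendsto_length_of_diam hdiam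
  have hg := two_deltaS_inv_pos
  have hD : C * 42 ^ (b / 2) * (9 ^ (1 / p.toReal)) ^ (1 - b) ≠ (∞ : ℝ≥0∞) := by
    have h1 : (42 : ℝ≥0∞) ^ (b / 2) ≠ ∞ :=
      ENNReal.rpow_ne_top_of_nonneg (by linarith) (by norm_num)
    have h2 : ((9 : ℝ≥0∞) ^ (1 / p.toReal)) ^ (1 - b) ≠ ∞ :=
      ENNReal.rpow_ne_top_of_nonneg (by linarith)
        (ENNReal.rpow_ne_top_of_nonneg (by positivity) (by norm_num))
    finiteness
  -- Rates: `1/δ` for `Y = σ`, and `1` for `Z = ν`; in part (b) the roles are exchanged.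
  have hrate := rate_le_of_inequality hw (fun n => (hpos n).ne') (fun n => measure_ne_top σ _)
    (fun n => by rw [nu_cell]; simp) (fun n => measure_ne_top nu _)
    (by positivity : 0 ≤ 1 / p.toReal) hb hb1 hlim
    (tendsto_log_nu_div_self hw) one_ne_zero ENNReal.one_ne_top hD (by
      filter_upwards [hw.eventually_gt_atTop 0] with n hn
      rw [one_mul]
      exact h.measure_cell_le hq hb hb1 (List.length_pos_iff.1 hn) (hpos n).ne')
  rw [expUpper_eq hq hδ]
  refine max_le ?_ hb
  rw [div_le_iff₀ (by positivity)]
  simpa [div_eq_mul_inv] using hrate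

theorem expLower_le {p q δ : ℝ≥0∞} (hp : 1 ≤ p) (hq : 1 ≤ q) (hδ : 0 < δ) {σ : Measure Gasket}
    [IsFiniteMeasure σ] (hσ : AttainsExponent σ δ) {b : ℝ} (hb : 0 ≤ b) (hb1 : b ≤ 1) {C : ℝ≥0}
    (h : SobolevIneq nu σ q p b C) : expLower p q δ ≤ b := by
  obtain ⟨w, hdiam, hpos, hlim⟩ := hσ
  have hw := tendsto_length_of_diam hdiam
  have hg := two_deltaS_inv_pos
  have hD : C * (14 * ENNReal.ofReal (5 / 3)) ^ (b / 2) ≠ (∞ : ℝ≥0∞) := by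
    have h1 : (14 * ENNReal.ofReal (5 / 3)) ^ (b / 2) ≠ ∞ :=
      ENNReal.rpow_ne_top_of_nonneg (by linarith) (by finiteness)
    finiteness
  have hc : ENNReal.ofReal (2 / 5) * (9⁻¹) ^ (1 / q.toReal) ≠ 0 :=
    mul_ne_zero (by simp) (by simp [ENNReal.rpow_eq_zero_iff])
  have hc' : ENNReal.ofReal (2 / 5) * (9⁻¹) ^ (1 / q.toReal) ≠ ∞ :=
    ENNReal.mul_ne_top ENNReal.ofReal_ne_top
      (ENNReal.rpow_ne_top_of_nonneg (by positivity) (by simp))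
  have hrate := rate_le_of_inequality hw (fun n => by rw [nu_cell]; simp)
    (fun n => measure_ne_top nu _) (fun n => (hpos n).ne') (fun n => measure_ne_top σ _)
    (by positivity : 0 ≤ 1 / p.toReal) hb hb1
    (tendsto_log_nu_div_self hw) hlim hc hc' hD
    (Eventually.of_forall fun n => h.nu_cell_le hq hb hb1 (w n))
  rw [expLower_eq hp hδ]
  refine max_le ?_ hb
  rw [div_le_iff₀ (by positivity)]
  simpa [div_eq_mul_inv] using hrate

end SierpinskiGasket

theorem mainTheorem5 :
    -- Part (a): inequalities, with a constant that depends only on `K`.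
    (∀ K : ℝ≥0, 0 < K → ∃ C : ℝ≥0, 0 < C ∧
      ∀ p q δ : ℝ≥0∞, 1 ≤ p → p ≤ q → 2 ≤ q → 1 ≤ δ →
      ∀ σ : Measure Gasket, IsFiniteMeasure σ → UpperRegular σ δ K →
        SobolevIneq σ nu q p (expUpper p q δ) C ∧
        InhomSobolevIneq σ nu q p (expUpper p q δ) C) ∧
    -- Part (a): optimality of the exponent.
    (∀ p q δ : ℝ≥0∞, 1 ≤ p → p ≤ q → 2 ≤ q → 1 ≤ δ →
      ∀ σ : Measure Gasket, IsFiniteMeasure σ →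
        (∃ K : ℝ≥0, 0 < K ∧ UpperRegular σ δ K) → AttainsExponent σ δ →
        ∀ b : ℝ, 0 ≤ b → b ≤ 1 → (∃ C : ℝ≥0, SobolevIneq σ nu q p b C) →
          expUpper p q δ ≤ b) ∧
    -- Part (b): inequalities, with a constant that depends only on `K`.
    (∀ K : ℝ≥0, 0 < K → ∃ C : ℝ≥0, 0 < C ∧
      ∀ p q δ : ℝ≥0∞, 1 ≤ p → p ≤ q → 2 ≤ q → 0 < δ →
      ∀ σ : Measure Gasket, IsFiniteMeasure σ → LowerRegular σ δ K →
        SobolevIneq nu σ q p (expLower p q δ) C ∧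
        InhomSobolevIneq nu σ q p (expLower p q δ) C) ∧
    -- Part (b): optimality of the exponent.
    (∀ p q δ : ℝ≥0∞, 1 ≤ p → p ≤ q → 2 ≤ q → 0 < δ →
      ∀ σ : Measure Gasket, IsFiniteMeasure σ →
        (∃ K : ℝ≥0, 0 < K ∧ LowerRegular σ δ K) → AttainsExponent σ δ →
        ∀ b : ℝ, 0 ≤ b → b ≤ 1 → (∃ C : ℝ≥0, SobolevIneq nu σ q p b C) →
          expLower p q δ ≤ b) := by

  -- The factor `70` is `7` from the scale inequality times `10` from the optimisation over scales.
  refine ⟨fun K _ => ⟨70 * max K 1 ^ 2, by positivity, ?_⟩, ?_,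
    fun K _ => ⟨70 * max K 1 ^ 2, by positivity, ?_⟩, ?_⟩
  · intro p q δ hp hpq hq2 hδ σ _ hσ
    exact sobolev_upper K hp hpq hq2 hδ σ hσ
  · rintro p q δ hp hpq - hδ σ _ - hσ b hb hb1 ⟨C, h⟩
    exact expUpper_le (hp.trans hpq) (zero_lt_one.trans_le hδ) hσ hb hb1 h
  · intro p q δ hp hpq hq2 hδ σ _ hσ
    exact sobolev_lower K hp hpq hq2 hδ σ hσ
  · rintro p q δ hp hpq - hδ σ _ - hσ b hb hb1 ⟨C, h⟩
    exact expLower_le hp (hp.trans hpq) hδ hσ hb hb1 h
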